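/- **Types and signatures.** Fix identifiers (used for variables and for contract names; `balance` is one of them) and let addresses be natural numbers. An integer type $\iota$ is $\mathtt{uint}_M$ or $\mathtt{int}_M$ with $M\in\{8,16,\dots,256\}$, with the usual range, or the unbounded type $\mathtt{int}$; write $n\in\iota$ if $n$ is in the range of $\iota$ (always, if $\iota$ is unbounded). Base types $\beta$ are the $\iota$, $\mathtt{bool}$ and $\mathtt{address}$; mapping types are $\mu ::= \beta \mid \mathtt{mapping}(\beta\Rightarrow\mu)$; ABI types are $\alpha ::= \beta \mid \mathtt{address}_A$; slot types are $\sigma ::= \mu\mid\alpha\mid A$, with $A$ a contract name. An interface $I=(x_i:\alpha_i)_i$ and a storage typing $C=(x_i:\sigma_i)_i$ are read as partial functions (the first entry for $x$ counts). A *signature* $\Sigma$ consists of partial functions on contract names: $\Sigma_{Storage}(A)$ is a storage typing, $\Sigma_{Cnstr}(A)$ a constructor, $\Sigma_{Trans}(A)$ a finite list of transitions. $\Sigma'\subset\Sigma$ means that all three components of $\Sigma'$ are restrictions of those of $\Sigma$ and $\Sigma'\ne\Sigma$. **Syntax.** - References: $r ::= x\mid \mathtt{pre}(x)\mid\mathtt{post}(x)\mid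 r\ \mathtt{as}\ A\mid r.x\mid r[e]\mid\mathtt{caller}\mid\mathtt{origin}\mid\mathtt{callvalue}\mid\mathtt{this}$. - Base expressions $e$: integer and boolean literals, $r$ (annotated with an ABI type), $\mathtt{addr}(r)$ (annotated with a contract name), $e_1\circ e_2$ with $\circ\in\{+,-,*,/,\%,\wedge\}$ ($\wedge$ is power) or a boolean connective (and, or, $\Rightarrow$) or a comparison $<,\le,\ge,>$, $\neg e$, $\mathtt{inrange}(\iota,e)$, $\mathtt{if}\ e_1\ \mathtt{then}\ e_2\ \mathtt{else}\ e_3$, $e_1=e_2$. - Mapping expressions: $m ::= e\mid [e_i\Rightarrow m_i]_i\mid r[e_i\Rightarrow m_i]_i$, the last two annotated with a mapping type. - Slot expressions: $se ::= m\mid r\ (\text{annotated with a contract name})\mid\mathtt{addr}(se)\mid\mathtt{new}\,A(se_1,\dots,se_n)\mid\mathtt{new}\,A\{\mathtt{value}: se\}(se_1,\dots,se_n)$. - A create is $\sigma\,x:=se$; an update is $r:=se$, with $r$ annotated with a slot type. - A constructor has an interface, a payability flag, boolean preconditions (iffs), postconditions, and finitely many cases, each a condition with a list of creates. A transition has an interface,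 a payability flag, an optional return type, iffs, postconditions, and finitely many cases, each a condition with a list of updates and an optional return expression. **Values, states, environments.** Base values are integers, booleans and addresses; values are base values, and functions from integers, booleans or addresses to values. A state $s$ is a partial function from addresses to pairs of a contract name and a store (a partial function from identifiers to values); $s(\ell)(x)$ is the value stored for $x$ at $\ell$. An environment $\rho$ is a partial function from identifiers and the three keywords $\mathtt{caller},\mathtt{origin},\mathtt{callvalue}$ (which are not identifiers) to base values. **Evaluation** (at a location $\ell$, in a state $s$ or, for *timed* references and base expressions, a pair $(s,s')$ of pre- and post-state). - References. Keywords are looked up in $\rho$, and $\mathtt{this}$ is $\ell$. In a single state, $x$ is $\rho(x)$ if $x\in\mathrm{dom}\,\rho$, and otherwise $s(\ell)(x)$. In a pair, $x$ is $\rho(x)$, with time "pre"; if $x\notin\mathrm{dom}\,\rho$, then $\mathtt{pre}(x)$ is $s(\ell)(x)$ with time "pre" and $\mathtt{post}(x)$ is $s'(\ell)(x)$ with time "post". $r\ \mathtt{as}\ A$ is $r$. $r.x$ evaluates $r$ to an address and reads $x$ there, in $s$, or in a pair in $s$ or $s'$ according to the time of $r$. $r[e]$ is function application. The time of $r$ is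 inherited by $r\ \mathtt{as}\ A$, $r.x$ and $r[e]$; keywords have no time. - Base expressions have the evident meaning: $\mathtt{addr}(r)$ evaluates as $r$; $\mathtt{inrange}(\iota,e)$ is the truth value of $n\in\iota$ for the value $n$ of $e$; division and remainder by $0$ give $0$; a power with negative exponent is undefined. - Mappings. $[e_i\Rightarrow m_i]_i$ evaluates to the function that takes the value of $m_i$ at the value of $e_i$ and the default value of the value type ($0$, false, address $0$, or the constant function) elsewhere; $r[e_i\Rightarrow m_i]_i$ overrides the value of $r$ in the same way. The first matching key counts. - Slot expressions evaluate to a value and a new state. Mapping expressions and references do not change the state, and $\mathtt{addr}(se)$ evaluates as $se$. $\mathtt{new}\,A(se_1,\dots,se_n)$, where the constructor $\Sigma_{Cnstr}(A)$ is not payable and has parameters $x_1,\dots,x_n$, evaluates $se_1,\dots,se_n$ in turn, threading the state, to base values $v_i$, and then runs the cases of the constructor in the resulting state and the environment $\{x_i\mapsto v_i\}\cup\{\mathtt{caller}\mapsto\ell,\ \mathtt{origin}\mapsto\rho(\mathtt{origin}),\ \mathtt{callvalue}\mapsto 0\}$; its value is the new location. $\mathtt{new}\,A\{\mathtt{value}:se\}(\dots)$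 is the same for a payable constructor, with $se$ evaluated after the arguments and $\mathtt{callvalue}$ bound to its value. - A list of creates for $A$ evaluates its right-hand sides in turn, threading the state, and then puts an instance of $A$ with the resulting store at $\ell=\max(\mathrm{dom}\ s)+1$, where $s$ is the state so reached and $\max\emptyset=0$. The cases of a constructor evaluate if exactly one condition evaluates to true and all others to false, and then run the creates of that case. Everything that belongs directly to a constructor (iffs, conditions, right-hand sides of creates) is evaluated at a fixed placeholder address $d$ (arbitrary, but the same throughout). - A list of updates evaluates all right-hand sides in turn, threading the state, and then writes the values in order; writing to $x$ (to $r.x$) changes the already existing entry $x$ in the store of $\ell$ (of the address that $r$ evaluates to in the current state). The cases of a transition evaluate as those of a constructor; the return expression of the chosen case is evaluated in the pair of the initial and the final state. - A constructor (transition) evaluates if all its iffs are true in the initial state and its cases evaluate. **Typing of values.** $n:\iota$ iff $n\in\iota$; a boolean has type $\mathtt{bool}$ and an address has type $\mathtt{address}$; a function has type $\mathtt{mapping}(\beta\Rightarrow\mu)$ iff its arguments are of the sort of $\beta$ and it sends all arguments of type $\beta$ to values of type $\mu$. Inductively, $\Sigma\vdash\ell:_s\mathtt{address}_A$ holds if $s(\ell)$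 is an instance of $A$, $\Sigma_{Storage}(A)=C$ is defined, the store at $\ell$ has the same domain as $C$, and $\Sigma\vdash s(\ell)(x):_s C(x)$ for every $x$ in it; and $\Sigma\vdash\ell:_s A$ holds iff $\Sigma\vdash\ell:_s\mathtt{address}_A$. $\Sigma\vdash\rho:_s I$ means that the identifiers in $\mathrm{dom}\,\rho$ are those of $I$, that $\Sigma\vdash\rho(x):_s I(x)$ for each of them, and that $\rho(\mathtt{caller}),\rho(\mathtt{origin})$ are addresses and $\rho(\mathtt{callvalue})$ is a $\mathtt{uint}_{256}$. **Entailment.** Let $\hat A$ be a contract name or absent. A configuration $(s,\rho,\ell)$ is well-typed for $\Sigma,I,\hat A$ if $\Sigma\vdash\rho:_s I$ and, if $\hat A=A$ is present, $\Sigma\vdash\ell:_s A$. $\Sigma;I;\Phi\vDash_{\hat A}e$ means that $e$ evaluates to true in all well-typed configurations in which $\Phi$ does. $\Sigma;I;\Phi\vDash_{\hat A}(se_1,\dots,se_n;\ x_1,\dots,x_n;\ P)$, for a list $P$ of expressions, means: whenever $\Phi$ evaluates to true in a well-typed configuration and $se_1,\dots,se_n$ evaluate there in turn, threading the state, to base values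 $v_1,\dots,v_n$, all members of $P$ evaluate to true at $d$ in the final state and the environment $\{x_i\mapsto v_i\}$ (without keywords). **Typing of expressions** (relative to $\Sigma,I,\hat A$, an expression $\Phi$, and a mode, timed or untimed). - References carry a tag, $S$ (storage) or $N$ (other). A variable $x$ of $I$ has type $I(x)$, tag $N$. If $\hat A=A$ and $x$ is not in $I$, then $x$ in untimed mode, and $\mathtt{pre}(x),\mathtt{post}(x)$ in timed mode, have type $\Sigma_{Storage}(A)(x)$, tag $S$. If $r:\mathtt{address}_A$, then $(r\ \mathtt{as}\ A):A$ and $r:\mathtt{address}$, tag $N$. If $r:A$, then $r.x:\Sigma_{Storage}(A)(x)$, with the tag of $r$. If $r:\mathtt{mapping}(\beta\Rightarrow\mu)$ and $e:\beta$ (with $\Phi=\mathtt{true}$), then $r[e]:\mu$, tag $N$. In untimed mode, with tag $N$, $\mathtt{caller},\mathtt{origin}:\mathtt{address}$, $\mathtt{callvalue}:\mathtt{uint}_{256}$, and $\mathtt{this}:\mathtt{address}_A$ if $\hat A=A$. - Base expressions. A literal $n$ has any type $\iota$ with $n\in\iota$; boolean literals have type $\mathtt{bool}$. A reference of type $\beta$,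 annotated $\beta$, has type $\beta$. $\mathtt{addr}(r):\mathtt{address}$ if $r:A$, annotated $A$, in untimed mode. If $e_1,e_2$ have integer types, $e_1\circ e_2$ has type $\iota$ for an arithmetic operator $\circ$ provided $\Sigma;I;\Phi\vDash_{\hat A}\mathtt{inrange}(\iota,e_1\circ e_2)$ in untimed mode, or provided $\iota$ is unbounded in timed mode. An expression of an integer type also has every integer type $\iota$ that is unbounded or satisfies $\Sigma;I;\Phi\vDash_{\hat A}\mathtt{inrange}(\iota,e)$. Boolean connectives take booleans to $\mathtt{bool}$; comparisons take two expressions of the same integer type, and $=$ two of the same base type, to $\mathtt{bool}$; $\mathtt{inrange}(\iota,e):\mathtt{bool}$ for $e$ of integer type; both branches of a conditional have its type, and its condition is boolean. - Mapping expressions (untimed). An expression of type $\beta$ has mapping type $\beta$. $[e_i\Rightarrow m_i]_i$ annotated $\mathtt{mapping}(\beta\Rightarrow\mu)$ has that type if all $e_i:\beta$, $m_i:\mu$; likewise $r[e_i\Rightarrow m_i]_i$, if also $r$ has that type. - Slot expressions (untimed). $m:\mu$ as a slot expression if as a mapping expression; $r:A$ if $r$ is a reference of type $A$, annotated $A$;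 $\mathtt{addr}(se):\mathtt{address}_A$ if $se:A$; $\mathtt{new}\,A(se_1,\dots,se_n):A$ if $\Sigma_{Cnstr}(A)$ is a constructor that is not payable, with interface $(x_i:\alpha_i)_{i\le n}$ and iffs $P$, $se_i:\alpha_i$ for all $i$, and $\Sigma;I;\Phi\vDash_{\hat A}(se_1,\dots,se_n;x_1,\dots,x_n;P)$; $\mathtt{new}\,A\{\mathtt{value}:se\}(\dots):A$ if the same holds for a payable constructor and $se:\mathtt{uint}_{256}$. **Typing of constructors and transitions.** An interface is well-formed in $\Sigma$ if each type $\mathtt{address}_A$ in it has $A\in\mathrm{dom}\,\Sigma_{Storage}$. A slot type is well-formed if it is a mapping type, or $\mathtt{address}_A$ or $A$ with $A\in\mathrm{dom}\,\Sigma_{Storage}$. $\Sigma\vdash_A c:C$, for a constructor $c$ with well-formed interface $I$ and iffs $P$, means: the iffs and the case conditions are boolean (untimed, $\Phi=\mathtt{true}$, $\hat A$ absent); for each case with condition $e$, the slot types in its creates $(\sigma_i\,x_i:=se_i)_i$ are well-formed, $C=(x_i:\sigma_i)_i$, $C(\mathtt{balance})=\mathtt{uint}_{256}$, and $se_i:\sigma_i$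 for all $i$ with $\Phi=e\ \text{and}\ \bigwedge P$ and $\hat A$ absent; $C$ and $I$ have no common variable; the postconditions are boolean (untimed) in $\Sigma$ extended by $\Sigma_{Storage}(A):=C$, with $\hat A=A$; and $\bigwedge P\Rightarrow$ "at least one, and no two, of the case conditions hold" is entailed ($\Phi=\mathtt{true}$, $\hat A$ absent). $\Sigma\vdash_A t$, for a transition $t$ with well-formed interface $I$ and iffs $P$, means, with $\hat A=A$ throughout: the iffs and the case conditions are boolean (untimed, $\Phi=\mathtt{true}$); for each case with condition $e$ and updates $(r_i:=se_i)_i$, each $r_i$ has its annotated type $\sigma_i$ with tag $S$, untimed, and $se_i:\sigma_i$ with $\Phi=e\ \text{and}\ \bigwedge P$, and for $j<i$ the reference $r_j$ is neither equal to $r_i$ nor of the form $r_i.y_1.\cdots.y_k$ with $k\ge 1$; each case has a return expression iff a return type is declared, and then the return type is a base type and the expression has that type in timed mode ($\Phi=\mathtt{true}$); the postconditions are boolean in timed mode; and $\bigwedge P\Rightarrow$ "at least one, and no two, of the case conditions hold" is entailed ($\Phi=\mathtt{true}$). **Well-typed signatures** form the least class such that $\Sigma$ is well-typed if 1. every $A\in\mathrm{dom}\,\Sigma_{Storage}$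 is in $\mathrm{dom}\,\Sigma_{Cnstr}$; 2. for every $A\in\mathrm{dom}\,\Sigma_{Cnstr}$ there is a well-typed $\Sigma'\subset\Sigma$ with $\Sigma'\vdash_A\Sigma_{Cnstr}(A):\Sigma_{Storage}(A)$ (in particular $\Sigma_{Storage}(A)$ is defined); 3. for every $A\in\mathrm{dom}\,\Sigma_{Trans}$ there is a well-typed $\Sigma'\subset\Sigma$ with $\Sigma'\vdash_A t$ for all $t$ in $\Sigma_{Trans}(A)$. **Steps.** A constructor step leads from $s$ to $s'$ if for some $A\in\mathrm{dom}\,\Sigma_{Cnstr}$ and some $\rho$ that is well-typed in $s$ for the interface of $\Sigma_{Cnstr}(A)$, that constructor evaluates from $s$ and $\rho$ to $s'$, creating an instance of $A$. A transition step leads from $s$ to $s'$ if for some $A$, some $\ell$ with $\Sigma\vdash\ell:_s A$, some transition $t$ in $\Sigma_{Trans}(A)$ and some $\rho$ that is well-typed in $s$ for the interface of $t$, $t$ evaluates at $\ell$ from $s$ and $\rho$ to $s'$. A state is *possible* if it is reached from the empty state by finitely many steps. **Lemma (reachable store is well-typed).** Let $\Sigma$ be a well-typed signature. For every possible state $s$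 and every $\ell\in\mathrm{dom}\,s$ there is a contract name $A$ with $\Sigma\vdash\ell:_s A$. -/

import Mathlib

namespace Act

/-! ## Identifiers, types -/

/-- Identifiers, both of variables (lower case) and of contracts (upper case). -/
abbrev Ident := String

/-- The storage variable called balance, spelled by code points. -/
def balanceName : Ident :=
  String.ofList ([98, 97, 108, 97, 110, 99, 101].map Char.ofNat)

abbrev Addr := ℕ

/-- Integer types. The index `k` stands for the width `M = 8 * (k + 1)`, so `M` runs through
`8, 16, ..., 256`; `unbounded` is the type of mathematical integers. -/
inductive IntTy where
  | uint (k : Fin 32)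
  | sint (k : Fin 32)
  | unbounded

/-- `ι.Mem n` : `min ι ≤ n ≤ max ι`, or `ι` is unbounded. -/
def IntTy.Mem : IntTy → ℤ → Prop
  | .uint k, n => 0 ≤ n ∧ n ≤ 2 ^ (8 * (k.val + 1)) - 1
  | .sint k, n => -2 ^ (8 * (k.val + 1) - 1) ≤ n ∧ n ≤ 2 ^ (8 * (k.val + 1) - 1) - 1
  | .unbounded, _ => True

/-- Base types. -/
inductive BaseTy where
  | int (ι : IntTy)
  | bool
  | address

def BaseTy.uint256 : BaseTy := .int (.uint 31)

/-- Mapping types; every base type is one. -/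
inductive MapTy where
  | base (β : BaseTy)
  | mapping (β : BaseTy) (μ : MapTy)

/-- ABI types; every base type is one. -/
inductive ABITy where
  | base (β : BaseTy)
  | addressOf (A : Ident)

/-- Slot types: mapping types, ABI types and contracts. A base type occurs once, as a mapping
type; `ABITy.toSlot` identifies it with the corresponding ABI type. -/
inductive SlotTy where
  | map (μ : MapTy)
  | addressOf (A : Ident)
  | contract (A : Ident)

def BaseTy.toSlot (β : BaseTy) : SlotTy := .map (.base β)

def ABITy.toSlot : ABITy → SlotTy
  | .base β => β.toSlot
  | .addressOf A => .addressOf A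

/-! ## Values, states, environments -/

/-- The three sorts of base values. -/
inductive Kind where
  | int
  | bool
  | addr

@[reducible] def Kind.Carrier : Kind → Type
  | .int => ℤ
  | .bool => Bool
  | .addr => Addr

instance Kind.decEqCarrier : (X : Kind) → DecidableEq X.Carrier
  | .int => inferInstanceAs (DecidableEq ℤ)
  | .bool => inferInstanceAs (DecidableEq Bool)
  | .addr => inferInstanceAs (DecidableEq ℕ)

inductive BaseValue where
  | int (n : ℤ)
  | bool (b : Bool)
  | addr (ℓ : Addr)

def Kind.inj : (X : Kind) → X.Carrier → BaseValue
  | .int, n => .int n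
  | .bool, b => .bool b
  | .addr, ℓ => .addr ℓ

/-- Values: base values, and functions to values on the integers, booleans or addresses. -/
inductive Value where
  | base (b : BaseValue)
  | fn (X : Kind) (f : X.Carrier → Value)

/-- The sort of the values of a base type. -/
def BaseTy.kind : BaseTy → Kind
  | .int _ => .int
  | .bool => .bool
  | .address => .addr

/-- The default value of a mapping type. -/
def MapTy.default : MapTy → Value
  | .base (.int _) => .base (.int 0)
  | .base .bool => .base (.bool false)
  | .base .address => .base (.addr 0)
  | .mapping β μ => .fn β.kind (fun _ => μ.default)

def vTrue : Value := .base (.bool true)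

def vFalse : Value := .base (.bool false)

/-- What a state holds at a location: the contract name and the storage. -/
structure Obj where
  type : Ident
  store : Ident → Option Value

/-- States: partial functions from addresses to contract instances. -/
abbrev State := Addr → Option Obj

def State.empty : State := fun _ => none

def State.dom (s : State) : Set Addr := {ℓ | (s ℓ).isSome}

/-- The value `s(ℓ)(x)`, if defined. -/
def State.read (s : State) (ℓ : Addr) (x : Ident) : Option Value :=
  (s ℓ).bind (fun o => o.store x)

/-- The keys of an environment: variables, and the three keywords, which are not variables. -/
inductive EnvKey where
  | var (x : Ident)
  | caller
  | origin
  | callvalue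

/-- Environments: partial functions from keys to base values. -/
abbrev Env := EnvKey → Option BaseValue

/-- `{xᵢ ↦ vᵢ}`, with no entry for the keywords. -/
def bindArgs (xs : List Ident) (bs : List BaseValue) : Env
  | .var x => (xs.zip bs).lookup x
  | _ => none

/-- `{xᵢ ↦ vᵢ} ∪ {caller ↦ c, origin ↦ o, callvalue ↦ w}`. -/
def callEnv (xs : List Ident) (bs : List BaseValue) (c o w : BaseValue) : Env
  | .var x => (xs.zip bs).lookup x
  | .caller => some c
  | .origin => some o
  | .callvalue => some w

/-! ## Syntax -/

inductive IntOp where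
  | add | sub | mul | div | mod | exp

inductive BoolOp where
  | and | or | imp

inductive CmpOp where
  | lt | le | ge | gt

/-- Keywords that refer to the calling environment. -/
inductive EnvRef where
  | caller | origin | callvalue | this

mutual
/-- Variable references. -/
inductive Ref where
  | var (x : Ident)
  | pre (x : Ident)
  | post (x : Ident)
  | coerce (r : Ref) (A : Ident)
  | field (r : Ref) (y : Ident)
  | index (r : Ref) (e : Exp)
  | env (k : EnvRef)
/-- Base expressions; references carry a type annotation. -/
inductive Exp where
  | int (n : ℤ)
  | bool (b : Bool)
  | ref (r : Ref) (ann : ABITy)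
  | addr (r : Ref) (ann : Ident)
  | bopI (op : IntOp) (e₁ e₂ : Exp)
  | bopB (op : BoolOp) (e₁ e₂ : Exp)
  | cmp (op : CmpOp) (e₁ e₂ : Exp)
  | neg (e : Exp)
  | inrange (ι : IntTy) (e : Exp)
  | ite (e₁ e₂ e₃ : Exp)
  | eq (e₁ e₂ : Exp)
end

/-- Mapping expressions: base expressions, `[eᵢ ⇒ mᵢ]` and `ref[eᵢ ⇒ mᵢ]`, annotated with a
mapping type. -/
inductive MapExp where
  | exp (e : Exp)
  | lit (n : ℕ) (keys : Fin n → Exp) (vals : Fin n → MapExp) (ann : MapTy)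
  | upd (r : Ref) (n : ℕ) (keys : Fin n → Exp) (vals : Fin n → MapExp) (ann : MapTy)

/-- Slot expressions. -/
inductive SlotExp where
  | map (m : MapExp)
  | new (A : Ident) (n : ℕ) (args : Fin n → SlotExp)
  | newPayable (A : Ident) (value : SlotExp) (n : ℕ) (args : Fin n → SlotExp)
  | ref (r : Ref) (ann : Ident)
  | addr (se : SlotExp)

/-- `σ x := se` -/
structure Create where
  ty : SlotTy
  name : Ident
  rhs : SlotExp

/-- `ref := se`, with the annotation of `ref`. -/
structure Update where
  ref : Ref
  ann : SlotTy
  rhs : SlotExp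

/-- Interfaces `(xᵢ : αᵢ)`. -/
abbrev Iface := List (Ident × ABITy)

/-- The interface as a partial function. -/
def Iface.ty (I : Iface) (x : Ident) : Option ABITy := List.lookup x I

def Iface.names (I : Iface) : List Ident := I.map Prod.fst

/-- `case cond : creates creates` -/
structure CtorCase where
  cond : Exp
  creates : List Create

structure Ctor where
  iface : Iface
  payable : Bool
  iffs : List Exp
  cases : List CtorCase
  posts : List Exp

/-- `case cond : updates updates [returns ret]` -/
structure TransCase where
  cond : Exp
  updates : List Update
  ret : Option Exp

structure Trans where
  name : Ident
  iface : Iface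
  payable : Bool
  retTy : Option ABITy
  iffs : List Exp
  cases : List TransCase
  posts : List Exp

/-- Storage typings of a contract. -/
abbrev StorageTy := Ident → Option SlotTy

/-- State typings (contract signatures). -/
structure Sig where
  storage : Ident → Option StorageTy
  cnstr : Ident → Option Ctor
  trans : Ident → Option (List Trans)

/-- `S` with `A : C` added to its storage typings. -/
def Sig.withStorage (S : Sig) (A : Ident) (C : StorageTy) : Sig :=
  { S with storage := Function.update S.storage A (some C) }

/-- Inclusion of signatures, as triples of partial functions. -/
def Sig.Sub (S₁ S : Sig) : Prop :=
  (∀ A C, S₁.storage A = some C → S.storage A = some C) ∧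
  (∀ A c, S₁.cnstr A = some c → S.cnstr A = some c) ∧
  (∀ A t, S₁.trans A = some t → S.trans A = some t)

def Sig.StrictSub (S₁ S : Sig) : Prop := S₁.Sub S ∧ S₁ ≠ S

/-- Finite conjunctions and disjunctions of expressions. -/
def bigAnd (es : List Exp) : Exp := es.foldr (Exp.bopB .and) (.bool true)

def bigOr (es : List Exp) : Exp := es.foldr (Exp.bopB .or) (.bool false)

/-- The list of all `¬ (eᵢ ∧ eⱼ)` with `i < j`. -/
def pairwiseExclusive : List Exp → List Exp
  | [] => []
  | e :: es => es.map (fun e₁ => .neg (.bopB .and e e₁)) ++ pairwiseExclusive es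

/-- `⋀ pres ⇒ ((⋁ᵢ eᵢ) ∧ ⋀_{i < j} ¬ (eᵢ ∧ eⱼ))` -/
def exactlyOneCase (pres conds : List Exp) : Exp :=
  .bopB .imp (bigAnd pres) (.bopB .and (bigOr conds) (bigAnd (pairwiseExclusive conds)))

/-! ## Semantics of references and base expressions -/

/-- A single state, or a pair of a pre-state and a post-state. -/
inductive TState where
  | untimed (s : State)
  | timed (pre post : State)

/-- The timing of an evaluated reference. -/
inductive RefTime where
  | untimed | pre | post

/-- Evaluation of environment references at the location `ℓ`. -/
inductive EvalEnv (ρ : Env) (ℓ : Addr) : EnvRef → BaseValue → Prop where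
  | caller {b} (h : ρ .caller = some b) : EvalEnv ρ ℓ .caller b
  | origin {b} (h : ρ .origin = some b) : EvalEnv ρ ℓ .origin b
  | callvalue {b} (h : ρ .callvalue = some b) : EvalEnv ρ ℓ .callvalue b
  | this : EvalEnv ρ ℓ .this (.addr ℓ)

/-- Integer operators other than division and remainder; a power with a negative exponent is
undefined. -/
def IntOp.eval : IntOp → ℤ → ℤ → Option ℤ
  | .add, a, b => some (a + b)
  | .sub, a, b => some (a - b)
  | .mul, a, b => some (a * b)
  | .exp, a, b => if 0 ≤ b then some (a ^ b.toNat) else none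
  | .div, _, _ => none
  | .mod, _, _ => none

def BoolOp.eval : BoolOp → Bool → Bool → Bool
  | .and, a, b => a && b
  | .or, a, b => a || b
  | .imp, a, b => !a || b

def CmpOp.eval : CmpOp → ℤ → ℤ → Bool
  | .lt, a, b => decide (a < b)
  | .le, a, b => decide (a ≤ b)
  | .ge, a, b => decide (a ≥ b)
  | .gt, a, b => decide (a > b)

mutual
/-- `EvalRef ts ρ ℓ r v t` : the reference `r` evaluates to `v` with timing `t`. -/
inductive EvalRef : TState → Env → Addr → Ref → Value → RefTime → Prop where
  | environment {ts ρ ℓ k b} (h : EvalEnv ρ ℓ k b) :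
      EvalRef ts ρ ℓ (.env k) (.base b) .untimed
  | storage {s : State} {ρ ℓ x v} (hx : s.read ℓ x = some v) (hρ : ρ (.var x) = none) :
      EvalRef (.untimed s) ρ ℓ (.var x) v .untimed
  | storagePre {s s₂ : State} {ρ ℓ x v} (hx : s.read ℓ x = some v) (hρ : ρ (.var x) = none) :
      EvalRef (.timed s s₂) ρ ℓ (.pre x) v .pre
  | storagePost {s s₂ : State} {ρ ℓ x v} (hx : s₂.read ℓ x = some v) (hρ : ρ (.var x) = none) :
      EvalRef (.timed s s₂) ρ ℓ (.post x) v .post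
  | calldata {s : State} {ρ ℓ x b} (h : ρ (.var x) = some b) :
      EvalRef (.untimed s) ρ ℓ (.var x) (.base b) .untimed
  | calldataTimed {s s₂ : State} {ρ ℓ x b} (h : ρ (.var x) = some b) :
      EvalRef (.timed s s₂) ρ ℓ (.var x) (.base b) .pre
  | coerce {ts ρ ℓ r A v t} (h : EvalRef ts ρ ℓ r v t) :
      EvalRef ts ρ ℓ (.coerce r A) v t
  | field {s : State} {ρ ℓ r ℓ₁ x v}
      (h : EvalRef (.untimed s) ρ ℓ r (.base (.addr ℓ₁)) .untimed)
      (hx : s.read ℓ₁ x = some v) :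
      EvalRef (.untimed s) ρ ℓ (.field r x) v .untimed
  | fieldPre {s s₂ : State} {ρ ℓ r ℓ₁ x v}
      (h : EvalRef (.timed s s₂) ρ ℓ r (.base (.addr ℓ₁)) .pre)
      (hx : s.read ℓ₁ x = some v) :
      EvalRef (.timed s s₂) ρ ℓ (.field r x) v .pre
  | fieldPost {s s₂ : State} {ρ ℓ r ℓ₁ x v}
      (h : EvalRef (.timed s s₂) ρ ℓ r (.base (.addr ℓ₁)) .post)
      (hx : s₂.read ℓ₁ x = some v) :
      EvalRef (.timed s s₂) ρ ℓ (.field r x) v .post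
  | index {ts ρ ℓ r e t} {X : Kind} {a : X.Carrier} {f : X.Carrier → Value}
      (he : EvalExp ts ρ ℓ e (.base (X.inj a)))
      (hr : EvalRef ts ρ ℓ r (.fn X f) t) :
      EvalRef ts ρ ℓ (.index r e) (f a) t
/-- `EvalExp ts ρ ℓ e v` : the base expression `e` evaluates to `v`. -/
inductive EvalExp : TState → Env → Addr → Exp → Value → Prop where
  | int {ts ρ ℓ n} : EvalExp ts ρ ℓ (.int n) (.base (.int n))
  | bool {ts ρ ℓ b} : EvalExp ts ρ ℓ (.bool b) (.base (.bool b))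
  | ref {ts ρ ℓ r ann v t} (h : EvalRef ts ρ ℓ r v t) : EvalExp ts ρ ℓ (.ref r ann) v
  | addr {ts ρ ℓ r ann v t} (h : EvalRef ts ρ ℓ r v t) : EvalExp ts ρ ℓ (.addr r ann) v
  | rangeTrue {ts ρ ℓ ι e n} (h : EvalExp ts ρ ℓ e (.base (.int n))) (hn : ι.Mem n) :
      EvalExp ts ρ ℓ (.inrange ι e) vTrue
  | rangeFalse {ts ρ ℓ ι e n} (h : EvalExp ts ρ ℓ e (.base (.int n))) (hn : ¬ ι.Mem n) :
      EvalExp ts ρ ℓ (.inrange ι e) vFalse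
  | div {ts ρ ℓ e₁ e₂ n₁ n₂} (h₁ : EvalExp ts ρ ℓ e₁ (.base (.int n₁)))
      (h₂ : EvalExp ts ρ ℓ e₂ (.base (.int n₂))) (h : n₂ ≠ 0) :
      EvalExp ts ρ ℓ (.bopI .div e₁ e₂) (.base (.int (n₁ / n₂)))
  | divZero {ts ρ ℓ e₁ e₂ n₁ n₂} (h₁ : EvalExp ts ρ ℓ e₁ (.base (.int n₁)))
      (h₂ : EvalExp ts ρ ℓ e₂ (.base (.int n₂))) (h : n₂ = 0) :
      EvalExp ts ρ ℓ (.bopI .div e₁ e₂) (.base (.int 0))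
  | mod {ts ρ ℓ e₁ e₂ n₁ n₂} (h₁ : EvalExp ts ρ ℓ e₁ (.base (.int n₁)))
      (h₂ : EvalExp ts ρ ℓ e₂ (.base (.int n₂))) (h : n₂ ≠ 0) :
      EvalExp ts ρ ℓ (.bopI .mod e₁ e₂) (.base (.int (n₁ % n₂)))
  | modZero {ts ρ ℓ e₁ e₂ n₁ n₂} (h₁ : EvalExp ts ρ ℓ e₁ (.base (.int n₁)))
      (h₂ : EvalExp ts ρ ℓ e₂ (.base (.int n₂))) (h : n₂ = 0) :
      EvalExp ts ρ ℓ (.bopI .mod e₁ e₂) (.base (.int 0))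
  | bopI {ts ρ ℓ op e₁ e₂ n₁ n₂ n} (h₁ : EvalExp ts ρ ℓ e₁ (.base (.int n₁)))
      (h₂ : EvalExp ts ρ ℓ e₂ (.base (.int n₂))) (h : op ≠ .div ∧ op ≠ .mod)
      (hn : op.eval n₁ n₂ = some n) :
      EvalExp ts ρ ℓ (.bopI op e₁ e₂) (.base (.int n))
  | bopB {ts ρ ℓ op e₁ e₂ b₁ b₂} (h₁ : EvalExp ts ρ ℓ e₁ (.base (.bool b₁)))
      (h₂ : EvalExp ts ρ ℓ e₂ (.base (.bool b₂))) :
      EvalExp ts ρ ℓ (.bopB op e₁ e₂) (.base (.bool (op.eval b₁ b₂)))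
  | neg {ts ρ ℓ e b} (h : EvalExp ts ρ ℓ e (.base (.bool b))) :
      EvalExp ts ρ ℓ (.neg e) (.base (.bool (!b)))
  | cmp {ts ρ ℓ op e₁ e₂ n₁ n₂} (h₁ : EvalExp ts ρ ℓ e₁ (.base (.int n₁)))
      (h₂ : EvalExp ts ρ ℓ e₂ (.base (.int n₂))) :
      EvalExp ts ρ ℓ (.cmp op e₁ e₂) (.base (.bool (op.eval n₁ n₂)))
  | iteTrue {ts ρ ℓ e₁ e₂ e₃ v} (h₁ : EvalExp ts ρ ℓ e₁ vTrue) (h₂ : EvalExp ts ρ ℓ e₂ v) :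
      EvalExp ts ρ ℓ (.ite e₁ e₂ e₃) v
  | iteFalse {ts ρ ℓ e₁ e₂ e₃ v} (h₁ : EvalExp ts ρ ℓ e₁ vFalse) (h₃ : EvalExp ts ρ ℓ e₃ v) :
      EvalExp ts ρ ℓ (.ite e₁ e₂ e₃) v
  | eqTrue {ts ρ ℓ e₁ e₂ v₁ v₂} (h₁ : EvalExp ts ρ ℓ e₁ v₁) (h₂ : EvalExp ts ρ ℓ e₂ v₂)
      (h : v₁ = v₂) : EvalExp ts ρ ℓ (.eq e₁ e₂) vTrue
  | eqFalse {ts ρ ℓ e₁ e₂ v₁ v₂} (h₁ : EvalExp ts ρ ℓ e₁ v₁) (h₂ : EvalExp ts ρ ℓ e₂ v₂)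
      (h : v₁ ≠ v₂) : EvalExp ts ρ ℓ (.eq e₁ e₂) vFalse
end

/-- `Insert ρ ℓ s r v s₂` : writing `v` at the reference `r` turns `s` into `s₂`. -/
inductive Insert (ρ : Env) (ℓ : Addr) : State → Ref → Value → State → Prop where
  | storage {s : State} {x v o} (ho : s ℓ = some o) (hx : (o.store x).isSome) :
      Insert ρ ℓ s (.var x) v
        (Function.update s ℓ (some { o with store := Function.update o.store x (some v) }))
  | field {s : State} {r ℓ₁ x v o}
      (hr : EvalRef (.untimed s) ρ ℓ r (.base (.addr ℓ₁)) .untimed)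
      (ho : s ℓ₁ = some o) (hx : (o.store x).isSome) :
      Insert ρ ℓ s (.field r x) v
        (Function.update s ℓ₁ (some { o with store := Function.update o.store x (some v) }))

/-! ## Semantics of mapping and slot expressions, creates and updates -/

/-- The function `a ↦ if a = kᵢ then uᵢ else g a` (with the first matching `i`). -/
def overrideFn {X : Kind} {n : ℕ} (k : Fin n → X.Carrier) (u : Fin n → Value)
    (g : X.Carrier → Value) : X.Carrier → Value :=
  fun a => ((List.ofFn (fun i => (k i, u i))).lookup a).getD (g a)

/-- Evaluation of mapping expressions. -/
inductive EvalMap (s : State) (ρ : Env) (ℓ : Addr) : MapExp → Value → Prop where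
  | exp {e v} (h : EvalExp (.untimed s) ρ ℓ e v) : EvalMap s ρ ℓ (.exp e) v
  | lit {n keys vals} {β : BaseTy} {μ : MapTy} {k : Fin n → β.kind.Carrier} {u : Fin n → Value}
      (hk : ∀ i, EvalExp (.untimed s) ρ ℓ (keys i) (.base (β.kind.inj (k i))))
      (hu : ∀ i, EvalMap s ρ ℓ (vals i) (u i)) :
      EvalMap s ρ ℓ (.lit n keys vals (.mapping β μ))
        (.fn β.kind (overrideFn k u (fun _ => μ.default)))
  | upd {r n keys vals t} {β : BaseTy} {μ : MapTy} {f : β.kind.Carrier → Value}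
      {k : Fin n → β.kind.Carrier} {u : Fin n → Value}
      (hr : EvalRef (.untimed s) ρ ℓ r (.fn β.kind f) t)
      (hk : ∀ i, EvalExp (.untimed s) ρ ℓ (keys i) (.base (β.kind.inj (k i))))
      (hu : ∀ i, EvalMap s ρ ℓ (vals i) (u i)) :
      EvalMap s ρ ℓ (.upd r n keys vals (.mapping β μ)) (.fn β.kind (overrideFn k u f))

/-- `IsFresh s ℓ` : `ℓ = max (dom s) + 1`, where the maximum of the empty set is `0`. -/
def IsFresh (s : State) (ℓ : Addr) : Prop := ∃ m, IsLUB s.dom m ∧ ℓ = m + 1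

mutual
/-- `EvalSlot S d s ρ ℓ se v s₂` : the slot expression `se` evaluates to `v` and changes the
state from `s` to `s₂`. -/
inductive EvalSlot (S : Sig) (d : Addr) :
    State → Env → Addr → SlotExp → Value → State → Prop where
  | map {s ρ ℓ m v} (h : EvalMap s ρ ℓ m v) : EvalSlot S d s ρ ℓ (.map m) v s
  | ref {s ρ ℓ r ann v t} (h : EvalRef (.untimed s) ρ ℓ r v t) :
      EvalSlot S d s ρ ℓ (.ref r ann) v s
  | addr {s ρ ℓ se v s₂} (h : EvalSlot S d s ρ ℓ se v s₂) :
      EvalSlot S d s ρ ℓ (.addr se) v s₂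
  | new {ρ ℓ A n args ctor o ℓ₁ s₂} {st : Fin (n + 1) → State} {b : Fin n → BaseValue}
      (hctor : S.cnstr A = some ctor) (hpay : ctor.payable = false)
      (hlen : ctor.iface.length = n)
      (hargs : ∀ i : Fin n,
        EvalSlot S d (st i.castSucc) ρ ℓ (args i) (.base (b i)) (st i.succ))
      (ho : ρ .origin = some o)
      (hcases : EvalCtorCases S d (st (Fin.last n))
        (callEnv ctor.iface.names (List.ofFn b) (.addr ℓ) o (.int 0)) ctor.cases A ℓ₁ s₂) :
      EvalSlot S d (st 0) ρ ℓ (.new A n args) (.base (.addr ℓ₁)) s₂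
  | newPayable {ρ ℓ A n args value ctor o w s₁ ℓ₁ s₂} {st : Fin (n + 1) → State}
      {b : Fin n → BaseValue}
      (hctor : S.cnstr A = some ctor) (hpay : ctor.payable = true)
      (hlen : ctor.iface.length = n)
      (hargs : ∀ i : Fin n,
        EvalSlot S d (st i.castSucc) ρ ℓ (args i) (.base (b i)) (st i.succ))
      (hvalue : EvalSlot S d (st (Fin.last n)) ρ ℓ value (.base w) s₁)
      (ho : ρ .origin = some o)
      (hcases : EvalCtorCases S d s₁
        (callEnv ctor.iface.names (List.ofFn b) (.addr ℓ) o w) ctor.cases A ℓ₁ s₂) :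
      EvalSlot S d (st 0) ρ ℓ (.newPayable A value n args) (.base (.addr ℓ₁)) s₂
/-- `EvalCreates S d s ρ cs A ℓ s₂` : the creates `cs` make a new instance of `A` at `ℓ`. -/
inductive EvalCreates (S : Sig) (d : Addr) :
    State → Env → List Create → Ident → Addr → State → Prop where
  | intro {ρ A ℓ} {cs : List Create} {st : Fin (cs.length + 1) → State}
      {v : Fin cs.length → Value}
      (hse : ∀ i : Fin cs.length,
        EvalSlot S d (st i.castSucc) ρ d (cs.get i).rhs (v i) (st i.succ))
      (hℓ : IsFresh (st (Fin.last cs.length)) ℓ) :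
      EvalCreates S d (st 0) ρ cs A ℓ
        (Function.update (st (Fin.last cs.length)) ℓ
          (some ⟨A, fun x => ((cs.map Create.name).zip (List.ofFn v)).lookup x⟩))
/-- `EvalCtorCases S d s ρ cases A ℓ s₂` : exactly one case condition holds, and its creates make
a new instance of `A` at `ℓ`. -/
inductive EvalCtorCases (S : Sig) (d : Addr) :
    State → Env → List CtorCase → Ident → Addr → State → Prop where
  | intro {s ρ A ℓ s₂} {cases : List CtorCase} (j : Fin cases.length)
      (hj : EvalExp (.untimed s) ρ d (cases.get j).cond vTrue)
      (hi : ∀ i : Fin cases.length, i ≠ j →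
        EvalExp (.untimed s) ρ d (cases.get i).cond vFalse)
      (hc : EvalCreates S d s ρ (cases.get j).creates A ℓ s₂) :
      EvalCtorCases S d s ρ cases A ℓ s₂
end

/-- All right-hand sides are evaluated first, then the values are written in order. -/
def EvalUpdates (S : Sig) (d : Addr) (s : State) (ρ : Env) (ℓ : Addr) (us : List Update)
    (s₂ : State) : Prop :=
  ∃ (st wr : Fin (us.length + 1) → State) (v : Fin us.length → Value),
    st 0 = s ∧
    (∀ i : Fin us.length,
      EvalSlot S d (st i.castSucc) ρ ℓ (us.get i).rhs (v i) (st i.succ)) ∧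
    wr 0 = st (Fin.last us.length) ∧
    (∀ i : Fin us.length,
      Insert ρ ℓ (wr i.castSucc) (us.get i).ref (v i) (wr i.succ)) ∧
    wr (Fin.last us.length) = s₂

/-- Evaluation of an optional return expression in a pair of states. -/
def EvalRet (s s₂ : State) (ρ : Env) (ℓ : Addr) : Option Exp → Option Value → Prop
  | none, w => w = none
  | some e, w => ∃ v, w = some v ∧ EvalExp (.timed s s₂) ρ ℓ e v

def EvalTransCases (S : Sig) (d : Addr) (s : State) (ρ : Env) (ℓ : Addr)
    (cases : List TransCase) (w : Option Value) (s₂ : State) : Prop :=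
  ∃ j : Fin cases.length,
    EvalExp (.untimed s) ρ ℓ (cases.get j).cond vTrue ∧
    (∀ i : Fin cases.length, i ≠ j → EvalExp (.untimed s) ρ ℓ (cases.get i).cond vFalse) ∧
    EvalUpdates S d s ρ ℓ (cases.get j).updates s₂ ∧
    EvalRet s s₂ ρ ℓ (cases.get j).ret w

def EvalCtor (S : Sig) (d : Addr) (s : State) (ρ : Env) (c : Ctor) (A : Ident) (ℓ : Addr)
    (s₂ : State) : Prop :=
  (∀ p ∈ c.iffs, EvalExp (.untimed s) ρ d p vTrue) ∧ EvalCtorCases S d s ρ c.cases A ℓ s₂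

def EvalTrans (S : Sig) (d : Addr) (s : State) (ρ : Env) (ℓ : Addr) (tr : Trans)
    (w : Option Value) (s₂ : State) : Prop :=
  (∀ p ∈ tr.iffs, EvalExp (.untimed s) ρ ℓ p vTrue) ∧ EvalTransCases S d s ρ ℓ tr.cases w s₂

/-! ## Typing of values and environments -/

inductive HasBaseTy : BaseValue → BaseTy → Prop where
  | addr {ℓ} : HasBaseTy (.addr ℓ) .address
  | bool {b} : HasBaseTy (.bool b) .bool
  | int {n ι} (h : ι.Mem n) : HasBaseTy (.int n) (.int ι)

inductive HasMapTy : Value → MapTy → Prop where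
  | base {b β} (h : HasBaseTy b β) : HasMapTy (.base b) (.base β)
  | mapping {β : BaseTy} {μ : MapTy} {f : β.kind.Carrier → Value}
      (h : ∀ a, HasBaseTy (β.kind.inj a) β → HasMapTy (f a) μ) :
      HasMapTy (.fn β.kind f) (.mapping β μ)

/-- Typing of values by slot types in the state `s`. -/
inductive HasSlotTy (S : Sig) (s : State) : Value → SlotTy → Prop where
  | map {v μ} (h : HasMapTy v μ) : HasSlotTy S s v (.map μ)
  | addrIsContract {ℓ o A C} (ho : s ℓ = some o) (hC : S.storage A = some C)
      (htype : o.type = A)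
      (hdom : ∀ x, (o.store x).isSome ↔ ∃ σ, C x = some σ)
      (hval : ∀ x σ v, C x = some σ → o.store x = some v → HasSlotTy S s v σ) :
      HasSlotTy S s (.base (.addr ℓ)) (.addressOf A)
  | contract {ℓ A} (h : HasSlotTy S s (.base (.addr ℓ)) (.addressOf A)) :
      HasSlotTy S s (.base (.addr ℓ)) (.contract A)

/-- Typing of a location by an optional contract; every location has type `none`. -/
def HasLocTy (S : Sig) (s : State) (ℓ : Addr) : Option Ident → Prop
  | none => True
  | some A => HasSlotTy S s (.base (.addr ℓ)) (.contract A)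

/-- Typing of environments by interfaces in the state `s`. -/
structure HasEnvTy (S : Sig) (s : State) (ρ : Env) (I : Iface) : Prop where
  dom : ∀ x, (ρ (.var x)).isSome ↔ (I.ty x).isSome
  vars : ∀ x α b, I.ty x = some α → ρ (.var x) = some b → HasSlotTy S s (.base b) α.toSlot
  caller : ∃ b, ρ .caller = some b ∧ HasBaseTy b .address
  origin : ∃ b, ρ .origin = some b ∧ HasBaseTy b .address
  callvalue : ∃ b, ρ .callvalue = some b ∧ HasBaseTy b BaseTy.uint256

/-! ## Semantic entailment -/

/-- `e` is true in all well-typed configurations in which `Φ` is true. -/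
def Entails (S : Sig) (I : Iface) (Φ : Exp) (A? : Option Ident) (e : Exp) : Prop :=
  ∀ (s : State) (ρ : Env) (ℓ : Addr), HasEnvTy S s ρ I → HasLocTy S s ℓ A? →
    EvalExp (.untimed s) ρ ℓ Φ vTrue → EvalExp (.untimed s) ρ ℓ e vTrue

/-- The preconditions `pres` of a constructor with parameters `xs` are true after evaluation of
the arguments `se`, in all well-typed configurations in which `Φ` is true. -/
def EntailsIffs (S : Sig) (d : Addr) (I : Iface) (Φ : Exp) (A? : Option Ident) {n : ℕ}
    (se : Fin n → SlotExp) (xs : List Ident) (pres : List Exp) : Prop :=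
  ∀ (st : Fin (n + 1) → State) (ρ : Env) (ℓ : Addr) (b : Fin n → BaseValue),
    HasEnvTy S (st 0) ρ I → HasLocTy S (st 0) ℓ A? →
    EvalExp (.untimed (st 0)) ρ ℓ Φ vTrue →
    (∀ i : Fin n, EvalSlot S d (st i.castSucc) ρ ℓ (se i) (.base (b i)) (st i.succ)) →
    ∀ p ∈ pres, EvalExp (.untimed (st (Fin.last n))) (bindArgs xs (List.ofFn b)) d p vTrue

/-! ## Typing -/

inductive ABIWf (S : Sig) : ABITy → Prop where
  | int {ι : IntTy} (h : ι ≠ .unbounded) : ABIWf S (.base (.int ι))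
  | contractAddr {α : ABITy} (h : ∀ A, α = .addressOf A → (S.storage A).isSome) : ABIWf S α

inductive SlotWf (S : Sig) : SlotTy → Prop where
  | contract {A} (h : (S.storage A).isSome) : SlotWf S (.contract A)
  | alpha {α : ABITy} (h : ABIWf S α) : SlotWf S α.toSlot
  | map {μ} : SlotWf S (.map μ)

def IfaceWf (S : Sig) (I : Iface) : Prop := ∀ p ∈ I, ABIWf S p.2

/-- Timing tag of a judgment. -/
inductive Timing where
  | untimed | timed

/-- Reference tag: `storage` for references reachable from the storage of the current contract
without coercion, `other` for all others. -/
inductive RefTag where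
  | storage | other

inductive EnvHasTy : Option Ident → EnvRef → ABITy → Prop where
  | caller {A?} : EnvHasTy A? .caller (.base .address)
  | origin {A?} : EnvHasTy A? .origin (.base .address)
  | callvalue {A?} : EnvHasTy A? .callvalue (.base BaseTy.uint256)
  | this {A} : EnvHasTy (some A) .this (.addressOf A)

mutual
/-- Typing of references. -/
inductive RefHasTy (S : Sig) (I : Iface) :
    RefTag → Option Ident → Timing → Ref → SlotTy → Prop where
  | calldata {A? t x α} (h : I.ty x = some α) :
      RefHasTy S I .other A? t (.var x) α.toSlot
  | storage {A C x σ} (hC : S.storage A = some C) (hx : C x = some σ) (hI : I.ty x = none) :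
      RefHasTy S I .storage (some A) .untimed (.var x) σ
  | storagePre {A C x σ} (hC : S.storage A = some C) (hx : C x = some σ) (hI : I.ty x = none) :
      RefHasTy S I .storage (some A) .timed (.pre x) σ
  | storagePost {A C x σ} (hC : S.storage A = some C) (hx : C x = some σ) (hI : I.ty x = none) :
      RefHasTy S I .storage (some A) .timed (.post x) σ
  | coerce {k A? t r A} (h : RefHasTy S I k A? t r (.addressOf A)) :
      RefHasTy S I .other A? t (.coerce r A) (.contract A)
  | upcast {k A? t r A} (h : RefHasTy S I k A? t r (.addressOf A)) :
      RefHasTy S I .other A? t r BaseTy.address.toSlot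
  | field {k A? t r A C x σ} (h : RefHasTy S I k A? t r (.contract A))
      (hC : S.storage A = some C) (hx : C x = some σ) :
      RefHasTy S I k A? t (.field r x) σ
  | index {k A? t r e β μ} (hr : RefHasTy S I k A? t r (.map (.mapping β μ)))
      (he : ExpHasTy S I (.bool true) A? t e β) :
      RefHasTy S I .other A? t (.index r e) (.map μ)
  | environment {A? k α} (h : EnvHasTy A? k α) :
      RefHasTy S I .other A? .untimed (.env k) α.toSlot
/-- Typing of base expressions. -/
inductive ExpHasTy (S : Sig) (I : Iface) :
    Exp → Option Ident → Timing → Exp → BaseTy → Prop where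
  | int {Φ A? t n ι} (h : ι.Mem n) : ExpHasTy S I Φ A? t (.int n) (.int ι)
  | bool {Φ A? t b} : ExpHasTy S I Φ A? t (.bool b) .bool
  | ref {Φ A? t k r β} (h : RefHasTy S I k A? t r β.toSlot) :
      ExpHasTy S I Φ A? t (.ref r (.base β)) β
  | addr {Φ A? k r A} (h : RefHasTy S I k A? .untimed r (.contract A)) :
      ExpHasTy S I Φ A? .untimed (.addr r A) .address
  | range {Φ A? t ι₁ ι₂ e} (h : ExpHasTy S I Φ A? t e (.int ι₂)) :
      ExpHasTy S I Φ A? t (.inrange ι₁ e) .bool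
  | bopI {Φ A? t op e₁ e₂ ι₁ ι₂ ι} (h₁ : ExpHasTy S I Φ A? t e₁ (.int ι₁))
      (h₂ : ExpHasTy S I Φ A? t e₂ (.int ι₂))
      (ht : t = .timed → ι = .unbounded)
      (hr : t = .untimed → Entails S I Φ A? (.inrange ι (.bopI op e₁ e₂))) :
      ExpHasTy S I Φ A? t (.bopI op e₁ e₂) (.int ι)
  | numConv {Φ A? t e ι₁ ι₂} (h : ExpHasTy S I Φ A? t e (.int ι₁))
      (hr : ι₂ ≠ .unbounded → Entails S I Φ A? (.inrange ι₂ e)) :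
      ExpHasTy S I Φ A? t e (.int ι₂)
  | bopB {Φ A? t op e₁ e₂} (h₁ : ExpHasTy S I Φ A? t e₁ .bool)
      (h₂ : ExpHasTy S I Φ A? t e₂ .bool) :
      ExpHasTy S I Φ A? t (.bopB op e₁ e₂) .bool
  | neg {Φ A? t e} (h : ExpHasTy S I Φ A? t e .bool) : ExpHasTy S I Φ A? t (.neg e) .bool
  | cmp {Φ A? t op e₁ e₂ ι} (h₁ : ExpHasTy S I Φ A? t e₁ (.int ι))
      (h₂ : ExpHasTy S I Φ A? t e₂ (.int ι)) :
      ExpHasTy S I Φ A? t (.cmp op e₁ e₂) .bool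
  | ite {Φ A? t e₁ e₂ e₃ β} (h₁ : ExpHasTy S I Φ A? t e₁ .bool)
      (h₂ : ExpHasTy S I Φ A? t e₂ β) (h₃ : ExpHasTy S I Φ A? t e₃ β) :
      ExpHasTy S I Φ A? t (.ite e₁ e₂ e₃) β
  | eq {Φ A? t e₁ e₂ β} (h₁ : ExpHasTy S I Φ A? t e₁ β) (h₂ : ExpHasTy S I Φ A? t e₂ β) :
      ExpHasTy S I Φ A? t (.eq e₁ e₂) .bool
end

/-- Typing of mapping expressions. -/
inductive MapHasTy (S : Sig) (I : Iface) (Φ : Exp) (A? : Option Ident) :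
    MapExp → MapTy → Prop where
  | exp {e β} (h : ExpHasTy S I Φ A? .untimed e β) : MapHasTy S I Φ A? (.exp e) (.base β)
  | lit {n keys vals β μ} (hk : ∀ i : Fin n, ExpHasTy S I Φ A? .untimed (keys i) β)
      (hv : ∀ i : Fin n, MapHasTy S I Φ A? (vals i) μ) :
      MapHasTy S I Φ A? (.lit n keys vals (.mapping β μ)) (.mapping β μ)
  | upd {k r n keys vals β μ} (hr : RefHasTy S I k A? .untimed r (.map (.mapping β μ)))
      (hk : ∀ i : Fin n, ExpHasTy S I Φ A? .untimed (keys i) β)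
      (hv : ∀ i : Fin n, MapHasTy S I Φ A? (vals i) μ) :
      MapHasTy S I Φ A? (.upd r n keys vals (.mapping β μ)) (.mapping β μ)

/-- Typing of slot expressions. -/
inductive SlotHasTy (S : Sig) (d : Addr) (I : Iface) (Φ : Exp) (A? : Option Ident) :
    SlotExp → SlotTy → Prop where
  | map {m μ} (h : MapHasTy S I Φ A? m μ) : SlotHasTy S d I Φ A? (.map m) (.map μ)
  | ref {k r A} (h : RefHasTy S I k A? .untimed r (.contract A)) :
      SlotHasTy S d I Φ A? (.ref r A) (.contract A)
  | addr {se A} (h : SlotHasTy S d I Φ A? se (.contract A)) :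
      SlotHasTy S d I Φ A? (.addr se) (.addressOf A)
  | new {A ctor} {args : Fin ctor.iface.length → SlotExp}
      (hctor : S.cnstr A = some ctor) (hpay : ctor.payable = false)
      (hargs : ∀ j, SlotHasTy S d I Φ A? (args j) (ctor.iface.get j).2.toSlot)
      (hiffs : EntailsIffs S d I Φ A? args ctor.iface.names ctor.iffs) :
      SlotHasTy S d I Φ A? (.new A ctor.iface.length args) (.contract A)
  | newPayable {A ctor value} {args : Fin ctor.iface.length → SlotExp}
      (hctor : S.cnstr A = some ctor) (hpay : ctor.payable = true)
      (hargs : ∀ j, SlotHasTy S d I Φ A? (args j) (ctor.iface.get j).2.toSlot)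
      (hvalue : SlotHasTy S d I Φ A? value BaseTy.uint256.toSlot)
      (hiffs : EntailsIffs S d I Φ A? args ctor.iface.names ctor.iffs) :
      SlotHasTy S d I Φ A? (.newPayable A value ctor.iface.length args) (.contract A)

/-- The storage typing `(xᵢ : σᵢ)` declared by a list of creates. -/
def storageOf (cs : List Create) : StorageTy :=
  fun x => (cs.map (fun c => (c.name, c.ty))).lookup x

/-- Typing of creates: they declare the storage `C`, which has a balance. -/
def CreatesHasTy (S : Sig) (d : Addr) (I : Iface) (Φ : Exp) (cs : List Create)
    (C : StorageTy) : Prop :=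
  (∀ c ∈ cs, SlotWf S c.ty) ∧ C = storageOf cs ∧
  C balanceName = some BaseTy.uint256.toSlot ∧
  (∀ c ∈ cs, SlotHasTy S d I Φ none c.rhs c.ty)

/-- `r₁` is strictly more specific than `r₂`. -/
inductive MoreSpecific : Ref → Ref → Prop where
  | base {r x} : MoreSpecific (.field r x) r
  | step {r₁ r₂ x} (h : MoreSpecific r₁ r₂) : MoreSpecific (.field r₁ x) r₂

/-- Typing of a list of updates: only storage references are updated, and no reference is updated
before an equal or less specific one. -/
def UpdatesWt (S : Sig) (d : Addr) (I : Iface) (Φ : Exp) (A : Ident) (us : List Update) : Prop :=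
  (∀ u ∈ us, RefHasTy S I .storage (some A) .untimed u.ref u.ann ∧
    SlotHasTy S d I Φ (some A) u.rhs u.ann) ∧
  us.Pairwise (fun uj ui => ¬ (uj.ref = ui.ref ∨ MoreSpecific uj.ref ui.ref))

/-- Typing of the optional return expression by the optional declared return type. -/
def RetHasTy (S : Sig) (I : Iface) (A : Ident) : Option Exp → Option ABITy → Prop
  | none, none => True
  | some e, some (.base β) => ExpHasTy S I (.bool true) (some A) .timed e β
  | _, _ => False

/-- The judgment `S ⊢_A ctor : C`. -/
structure CtorHasTy (S : Sig) (d : Addr) (A : Ident) (c : Ctor) (C : StorageTy) : Prop where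
  wf : IfaceWf S c.iface
  iffs : ∀ p ∈ c.iffs, ExpHasTy S c.iface (.bool true) none .untimed p .bool
  conds : ∀ k ∈ c.cases, ExpHasTy S c.iface (.bool true) none .untimed k.cond .bool
  creates : ∀ k ∈ c.cases,
    CreatesHasTy S d c.iface (.bopB .and k.cond (bigAnd c.iffs)) k.creates C
  disjoint : ∀ x, C x = none ∨ c.iface.ty x = none
  posts : ∀ p ∈ c.posts,
    ExpHasTy (S.withStorage A C) c.iface (.bool true) (some A) .untimed p .bool
  oneCase : Entails S c.iface (.bool true) none
    (exactlyOneCase c.iffs (c.cases.map CtorCase.cond))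

/-- The judgment `S ⊢_A trans`. -/
structure TransWt (S : Sig) (d : Addr) (A : Ident) (tr : Trans) : Prop where
  wf : IfaceWf S tr.iface
  iffs : ∀ p ∈ tr.iffs, ExpHasTy S tr.iface (.bool true) (some A) .untimed p .bool
  conds : ∀ k ∈ tr.cases, ExpHasTy S tr.iface (.bool true) (some A) .untimed k.cond .bool
  updates : ∀ k ∈ tr.cases,
    UpdatesWt S d tr.iface (.bopB .and k.cond (bigAnd tr.iffs)) A k.updates
  rets : ∀ k ∈ tr.cases, RetHasTy S tr.iface A k.ret tr.retTy
  posts : ∀ p ∈ tr.posts, ExpHasTy S tr.iface (.bool true) (some A) .timed p .bool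
  oneCase : Entails S tr.iface (.bool true) (some A)
    (exactlyOneCase tr.iffs (tr.cases.map TransCase.cond))

/-- Well-typed signatures. `T A` and `U A` are the smaller well-typed signatures in which the
constructor and the transitions of `A` are typed. By `dom` every contract with a storage typing
has a constructor. -/
inductive WellTyped (d : Addr) : Sig → Prop where
  | intro {S : Sig} (T U : Ident → Sig)
      (dom : ∀ A, (S.storage A).isSome → (S.cnstr A).isSome)
      (cnstrSub : ∀ A, (S.cnstr A).isSome → (T A).StrictSub S)
      (cnstrWt : ∀ A, (S.cnstr A).isSome → WellTyped d (T A))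
      (cnstrTy : ∀ A c, S.cnstr A = some c →
        ∃ C, S.storage A = some C ∧ CtorHasTy (T A) d A c C)
      (transSub : ∀ A, (S.trans A).isSome → (U A).StrictSub S)
      (transWt : ∀ A, (S.trans A).isSome → WellTyped d (U A))
      (transTy : ∀ A trs, S.trans A = some trs → ∀ tr ∈ trs, TransWt (U A) d A tr) :
      WellTyped d S

/-! ## Transitions between states -/

/-- A constructor step, which creates an instance of `A` at `ℓ`. -/
def StepCnstr (S : Sig) (d : Addr) (A : Ident) (ℓ : Addr) (s s₂ : State) : Prop :=
  ∃ ρ c, S.cnstr A = some c ∧ HasEnvTy S s ρ c.iface ∧ EvalCtor S d s ρ c A ℓ s₂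

/-- A transition step of the instance of `A` at `ℓ`. -/
def StepTrans (S : Sig) (d : Addr) (A : Ident) (ℓ : Addr) (s s₂ : State) : Prop :=
  ∃ ρ trs tr w, HasSlotTy S s (.base (.addr ℓ)) (.contract A) ∧
    S.trans A = some trs ∧ tr ∈ trs ∧ HasEnvTy S s ρ tr.iface ∧ EvalTrans S d s ρ ℓ tr w s₂

def Step (S : Sig) (d : Addr) (s s₂ : State) : Prop :=
  (∃ A ℓ, StepCnstr S d A ℓ s s₂) ∨ (∃ A ℓ, StepTrans S d A ℓ s s₂)

/-- Reachability from the empty state. -/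
def Possible (S : Sig) (d : Addr) (s : State) : Prop :=
  Relation.ReflTransGen (Step S d) State.empty s

end Act

namespace Act

/-! ## Determinism and monotonicity of evaluation -/

theorem Kind.inj_sigma {X Y : Kind} {a : X.Carrier} {b : Y.Carrier} (h : X.inj a = Y.inj b) :
    X = Y ∧ HEq a b := by
  cases X <;> cases Y <;> simp_all [Kind.inj]

mutual
theorem EvalRef.det {ts : TState} {ρ : Env} {ℓ : Addr} {r : Ref} {v : Value} {t : RefTime} :
    EvalRef ts ρ ℓ r v t → ∀ {v' t'}, EvalRef ts ρ ℓ r v' t' → v = v' ∧ t = t'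
  | .environment h, _, _, h' => by
    cases h' with
    | environment h' => cases h <;> cases h' <;> simp_all
  | .storage hx hρ, _, _, h' => by cases h' <;> simp_all
  | .storagePre hx hρ, _, _, h' => by cases h'; simp_all
  | .storagePost hx hρ, _, _, h' => by cases h'; simp_all
  | .calldata hx, _, _, h' => by cases h' <;> simp_all
  | .calldataTimed hx, _, _, h' => by cases h'; simp_all
  | .coerce h, _, _, .coerce h' => h.det h'
  | .field h hx, _, _, .field h' hx' => by
    obtain ⟨e, -⟩ := h.det h'
    cases e; simp_all
  | .fieldPre h hx, _, _, h'' => by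
    cases h'' with
    | fieldPre h' hx' => obtain ⟨e, -⟩ := h.det h'; cases e; simp_all
    | fieldPost h' hx' => obtain ⟨-, e⟩ := h.det h'; cases e
  | .fieldPost h hx, _, _, h'' => by
    cases h'' with
    | fieldPre h' hx' => obtain ⟨-, e⟩ := h.det h'; cases e
    | fieldPost h' hx' => obtain ⟨e, -⟩ := h.det h'; cases e; simp_all
  | @EvalRef.index _ _ _ _ _ _ X a f he hr, _, _, h'' => by
    cases h'' with
    | index he' hr' =>
      have e := he.det he'
      obtain ⟨e', rfl⟩ := hr.det hr'
      cases e'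
      injection e with e
      obtain ⟨-, e⟩ := Kind.inj_sigma e
      cases e
      exact ⟨rfl, rfl⟩
theorem EvalExp.det {ts : TState} {ρ : Env} {ℓ : Addr} {e : Exp} {v : Value} :
    EvalExp ts ρ ℓ e v → ∀ {v'}, EvalExp ts ρ ℓ e v' → v = v'
  | .int, _, .int => rfl
  | .bool, _, .bool => rfl
  | .ref h, _, .ref h' => (h.det h').1
  | .addr h, _, .addr h' => (h.det h').1
  | .rangeTrue h hn, _, h' => by
    cases h' with
    | rangeTrue => rfl
    | rangeFalse h' hn' => cases h.det h'; exact absurd hn hn'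
  | .rangeFalse h hn, _, h' => by
    cases h' with
    | rangeFalse => rfl
    | rangeTrue h' hn' => cases h.det h'; exact absurd hn' hn
  | .div h₁ h₂ h, _, h' => by
    cases h' with
    | div h₁' h₂' => cases h₁.det h₁'; cases h₂.det h₂'; rfl
    | divZero h₁' h₂' h0 => cases h₂.det h₂'; exact absurd h0 h
    | bopI _ _ h' => exact absurd rfl h'.1
  | .divZero h₁ h₂ h, _, h' => by
    cases h' with
    | divZero => rfl
    | div h₁' h₂' h0 => cases h₂.det h₂'; exact absurd h h0
    | bopI _ _ h' => exact absurd rfl h'.1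
  | .mod h₁ h₂ h, _, h' => by
    cases h' with
    | mod h₁' h₂' => cases h₁.det h₁'; cases h₂.det h₂'; rfl
    | modZero h₁' h₂' h0 => cases h₂.det h₂'; exact absurd h0 h
    | bopI _ _ h' => exact absurd rfl h'.2
  | .modZero h₁ h₂ h, _, h' => by
    cases h' with
    | modZero => rfl
    | mod h₁' h₂' h0 => cases h₂.det h₂'; exact absurd h h0
    | bopI _ _ h' => exact absurd rfl h'.2
  | .bopI h₁ h₂ h hn, _, h' => by
    cases h' with
    | bopI h₁' h₂' h' hn' => cases h₁.det h₁'; cases h₂.det h₂'; simp_all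
    | div => exact absurd rfl h.1
    | divZero => exact absurd rfl h.1
    | mod => exact absurd rfl h.2
    | modZero => exact absurd rfl h.2
  | .bopB h₁ h₂, _, .bopB h₁' h₂' => by cases h₁.det h₁'; cases h₂.det h₂'; rfl
  | .neg h, _, .neg h' => by cases h.det h'; rfl
  | .cmp h₁ h₂, _, .cmp h₁' h₂' => by cases h₁.det h₁'; cases h₂.det h₂'; rfl
  | .iteTrue h₁ h₂, _, h' => by
    cases h' with
    | iteTrue h₁' h₂' => exact h₂.det h₂'
    | iteFalse h₁' h₂' => cases h₁.det h₁'
  | .iteFalse h₁ h₂, _, h' => by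
    cases h' with
    | iteTrue h₁' h₂' => cases h₁.det h₁'
    | iteFalse h₁' h₂' => exact h₂.det h₂'
  | .eqTrue h₁ h₂ h, _, h' => by
    cases h' with
    | eqTrue => rfl
    | eqFalse h₁' h₂' h' => cases h₁.det h₁'; cases h₂.det h₂'; exact absurd h h'
  | .eqFalse h₁ h₂ h, _, h' => by
    cases h' with
    | eqFalse => rfl
    | eqTrue h₁' h₂' h' => cases h₁.det h₁'; cases h₂.det h₂'; exact absurd h' h
end

/-- `s'` contains all objects of `s`, unchanged. -/
def State.Ext (s s' : State) : Prop := ∀ ℓ o, s ℓ = some o → s' ℓ = some o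

theorem State.Ext.refl (s : State) : s.Ext s := fun _ _ h => h

theorem State.Ext.trans {s₁ s₂ s₃ : State} (h : s₁.Ext s₂) (h' : s₂.Ext s₃) : s₁.Ext s₃ :=
  fun ℓ o ho => h' ℓ o (h ℓ o ho)

theorem State.Ext.read {s s' : State} (h : s.Ext s') {ℓ x v} (hx : s.read ℓ x = some v) :
    s'.read ℓ x = some v := by
  unfold State.read at *
  cases ho : s ℓ with
  | none => simp [ho] at hx
  | some o => simp_all [h ℓ o ho]

/-- `ρ'` has the same variables as `ρ`, and at least its keywords. -/
def EnvExt (ρ ρ' : Env) : Prop :=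
  (∀ x, ρ' (.var x) = ρ (.var x)) ∧ ∀ k b, ρ k = some b → ρ' k = some b

theorem EnvExt.refl (ρ : Env) : EnvExt ρ ρ := ⟨fun _ => rfl, fun _ _ h => h⟩

theorem EvalEnv.mono {ρ ρ' : Env} (h : EnvExt ρ ρ') {ℓ k b} (hk : EvalEnv ρ ℓ k b) :
    EvalEnv ρ' ℓ k b := by
  cases hk with
  | caller hk => exact .caller (h.2 _ _ hk)
  | origin hk => exact .origin (h.2 _ _ hk)
  | callvalue hk => exact .callvalue (h.2 _ _ hk)
  | this => exact .this

/-- Componentwise extension of states or pairs of states. -/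
inductive TState.Ext : TState → TState → Prop where
  | untimed {s s'} (h : State.Ext s s') : TState.Ext (.untimed s) (.untimed s')
  | timed {s s' p p'} (h : State.Ext s s') (h' : State.Ext p p') :
      TState.Ext (.timed s p) (.timed s' p')

mutual
theorem EvalRef.mono {ts ts' : TState} {ρ ρ' : Env} (hs : ts.Ext ts') (he : EnvExt ρ ρ')
    {ℓ : Addr} {r : Ref} {v : Value} {t : RefTime} :
    EvalRef ts ρ ℓ r v t → EvalRef ts' ρ' ℓ r v t
  | .environment h => .environment (h.mono he)
  | .storage hx hρ => by cases hs with | untimed hs => exact .storage (hs.read hx) (by rw [he.1, hρ])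
  | .storagePre hx hρ => by
    cases hs with | timed hs hs' => exact .storagePre (hs.read hx) (by rw [he.1, hρ])
  | .storagePost hx hρ => by
    cases hs with | timed hs hs' => exact .storagePost (hs'.read hx) (by rw [he.1, hρ])
  | .calldata hx => by cases hs; exact .calldata (he.2 _ _ hx)
  | .calldataTimed hx => by cases hs; exact .calldataTimed (he.2 _ _ hx)
  | .coerce h => .coerce (h.mono hs he)
  | .field h hx => by
    have h' := h.mono hs he
    cases hs with | untimed hs => exact .field h' (hs.read hx)
  | .fieldPre h hx => by
    have h' := h.mono hs he
    cases hs with | timed hs hs' => exact .fieldPre h' (hs.read hx)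
  | .fieldPost h hx => by
    have h' := h.mono hs he
    cases hs with | timed hs hs' => exact .fieldPost h' (hs'.read hx)
  | @EvalRef.index _ _ _ _ _ _ X a f h hr => .index (h.mono hs he) (hr.mono hs he)
theorem EvalExp.mono {ts ts' : TState} {ρ ρ' : Env} (hs : ts.Ext ts') (he : EnvExt ρ ρ')
    {ℓ : Addr} {e : Exp} {v : Value} :
    EvalExp ts ρ ℓ e v → EvalExp ts' ρ' ℓ e v
  | .int => .int
  | .bool => .bool
  | .ref h => .ref (h.mono hs he)
  | .addr h => .addr (h.mono hs he)
  | .rangeTrue h hn => .rangeTrue (h.mono hs he) hn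
  | .rangeFalse h hn => .rangeFalse (h.mono hs he) hn
  | .div h₁ h₂ h => .div (h₁.mono hs he) (h₂.mono hs he) h
  | .divZero h₁ h₂ h => .divZero (h₁.mono hs he) (h₂.mono hs he) h
  | .mod h₁ h₂ h => .mod (h₁.mono hs he) (h₂.mono hs he) h
  | .modZero h₁ h₂ h => .modZero (h₁.mono hs he) (h₂.mono hs he) h
  | .bopI h₁ h₂ h hn => .bopI (h₁.mono hs he) (h₂.mono hs he) h hn
  | .bopB h₁ h₂ => .bopB (h₁.mono hs he) (h₂.mono hs he)
  | .neg h => .neg (h.mono hs he)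
  | .cmp h₁ h₂ => .cmp (h₁.mono hs he) (h₂.mono hs he)
  | .iteTrue h₁ h₂ => .iteTrue (h₁.mono hs he) (h₂.mono hs he)
  | .iteFalse h₁ h₂ => .iteFalse (h₁.mono hs he) (h₂.mono hs he)
  | .eqTrue h₁ h₂ h => .eqTrue (h₁.mono hs he) (h₂.mono hs he) h
  | .eqFalse h₁ h₂ h => .eqFalse (h₁.mono hs he) (h₂.mono hs he) h
end

/-! ## Typing up to the contents of the referenced contracts -/

/-- Typing of values that looks at the contract name at an address, but not at its store. -/
inductive Shape (s : State) : Value → SlotTy → Prop where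
  | map {v μ} (h : HasMapTy v μ) : Shape s v (.map μ)
  | addressOf {ℓ o} (h : s ℓ = some o) : Shape s (.base (.addr ℓ)) (.addressOf o.type)
  | contract {ℓ o} (h : s ℓ = some o) : Shape s (.base (.addr ℓ)) (.contract o.type)

/-- Every object of `s` is an object, with the same contract name, of `s'`. -/
def State.TyLe (s s' : State) : Prop :=
  ∀ ℓ o, s ℓ = some o → ∃ o', s' ℓ = some o' ∧ o'.type = o.type

theorem State.Ext.tyLe {s s' : State} (h : s.Ext s') : s.TyLe s' :=
  fun ℓ o ho => ⟨o, h ℓ o ho, rfl⟩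

theorem State.TyLe.trans {s₁ s₂ s₃ : State} (h : s₁.TyLe s₂) (h' : s₂.TyLe s₃) : s₁.TyLe s₃ := by
  intro ℓ o ho
  obtain ⟨o₁, h₁, e₁⟩ := h ℓ o ho
  obtain ⟨o₂, h₂, e₂⟩ := h' ℓ o₁ h₁
  exact ⟨o₂, h₂, e₂.trans e₁⟩

theorem Shape.mono {s s' : State} (hs : s.TyLe s') {v σ} (h : Shape s v σ) : Shape s' v σ := by
  cases h with
  | map h => exact .map h
  | addressOf h => obtain ⟨o', h', e⟩ := hs _ _ h; exact e ▸ .addressOf h'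
  | contract h => obtain ⟨o', h', e⟩ := hs _ _ h; exact e ▸ .contract h'

theorem HasSlotTy.shape {S : Sig} {s : State} {v σ} (h : HasSlotTy S s v σ) : Shape s v σ := by
  induction h with
  | map h => exact .map h
  | addrIsContract ho hC htype => exact htype ▸ .addressOf ho
  | contract h ih => cases ih with | addressOf ho => exact .contract ho

/-- An object whose contract `S` declares, with a constructor that has some case, and whose store
conforms to the storage typing of the contract, up to the contents of other contracts. -/
structure ObjWf (S : Sig) (s : State) (o : Obj) (C : StorageTy) (c : Ctor) : Prop where
  storage : S.storage o.type = some C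
  cnstr : S.cnstr o.type = some c
  cases : c.cases ≠ []
  dom : ∀ x, (o.store x).isSome ↔ ∃ σ, C x = some σ
  vals : ∀ x σ v, C x = some σ → o.store x = some v → Shape s v σ

/-- All objects of the state are well-formed. -/
def StateWf (S : Sig) (s : State) : Prop := ∀ ℓ o, s ℓ = some o → ∃ C c, ObjWf S s o C c

theorem ObjWf.mono {S : Sig} {s s' : State} (hs : s.TyLe s') {o C c} (h : ObjWf S s o C c) :
    ObjWf S s' o C c :=
  { h with vals := fun x σ v hx hv => (h.vals x σ v hx hv).mono hs }

theorem StateWf.read {S : Sig} {s : State} (hs : StateWf S s) {ℓ o C x σ v} (ho : s ℓ = some o)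
    (hC : S.storage o.type = some C) (hσ : C x = some σ) (hx : s.read ℓ x = some v) :
    Shape s v σ := by
  obtain ⟨C', c, h⟩ := hs ℓ o ho
  cases hC.symm.trans h.storage
  exact h.vals x σ v hσ (by simpa [State.read, ho] using hx)

theorem Sig.Sub.refl (S : Sig) : S.Sub S := ⟨fun _ _ h => h, fun _ _ h => h, fun _ _ h => h⟩

theorem Sig.Sub.trans {S₁ S₂ S₃ : Sig} (h : S₁.Sub S₂) (h' : S₂.Sub S₃) : S₁.Sub S₃ :=
  ⟨fun A C hC => h'.1 A C (h.1 A C hC), fun A c hc => h'.2.1 A c (h.2.1 A c hc),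
    fun A t ht => h'.2.2 A t (h.2.2 A t ht)⟩

theorem HasSlotTy.mono_sig {S₁ S : Sig} (hS : S₁.Sub S) {s v σ} (h : HasSlotTy S₁ s v σ) :
    HasSlotTy S s v σ := by
  induction h with
  | map h => exact .map h
  | addrIsContract ho hC htype hdom _ ih =>
    exact .addrIsContract ho (hS.1 _ _ hC) htype hdom ih
  | contract h ih => exact .contract ih

theorem HasSlotTy.mono_state {S : Sig} {s s' : State} (hs : s.Ext s') {v σ}
    (h : HasSlotTy S s v σ) : HasSlotTy S s' v σ := by
  induction h with
  | map h => exact .map h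
  | addrIsContract ho hC htype hdom _ ih => exact .addrIsContract (hs _ _ ho) hC htype hdom ih
  | contract h ih => exact .contract ih

/-- The contracts that occur in the slot type are in the domain of the storage typings. -/
inductive SlotTy.Declared (S : Sig) : SlotTy → Prop where
  | map {μ} : SlotTy.Declared S (.map μ)
  | addressOf {A} (h : (S.storage A).isSome) : SlotTy.Declared S (.addressOf A)
  | contract {A} (h : (S.storage A).isSome) : SlotTy.Declared S (.contract A)

theorem ABIWf.declared {S : Sig} {α : ABITy} (h : ABIWf S α) : α.toSlot.Declared S := by
  cases h with
  | int => exact .map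
  | contractAddr h =>
    cases α with
    | base => exact .map
    | addressOf A => exact .addressOf (h A rfl)

theorem SlotWf.declared {S : Sig} {σ : SlotTy} (h : SlotWf S σ) : σ.Declared S := by
  cases h with
  | contract h => exact .contract h
  | alpha h => exact h.declared
  | map => exact .map

theorem HasSlotTy.declared {S : Sig} {s : State} {v σ} (h : HasSlotTy S s v σ) : σ.Declared S := by
  induction h with
  | map h => exact .map
  | addrIsContract ho hC htype => exact .addressOf (by simp [hC])
  | contract h ih => cases ih with | addressOf h => exact .contract h

theorem lookup_zip_eq {κ γ : Type*} [BEq κ] [LawfulBEq κ] {ks : List κ} {vs : List γ}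
    (hl : ks.length = vs.length) (x : κ) :
    (ks.zip vs).lookup x = (vs[ks.idxOf x]?) := by
  induction ks generalizing vs with
  | nil => cases vs <;> simp_all
  | cons k ks ih =>
    cases vs with
    | nil => simp at hl
    | cons v vs =>
      simp only [List.length_cons, Nat.add_right_cancel_iff] at hl
      by_cases h : k = x
      · subst h; simp
      · have h' : (x == k) = false := by simpa using fun e => h e.symm
        simp [List.lookup_cons, h', List.idxOf_cons_ne _ h, ih hl]

theorem lookup_map_eq {δ κ γ : Type*} [BEq κ] [LawfulBEq κ] (l : List δ) (f : δ → κ) (g : δ → γ)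
    (x : κ) : (l.map (fun a => (f a, g a))).lookup x = (l[(l.map f).idxOf x]?).map g := by
  rw [← List.zip_map', lookup_zip_eq (by simp), List.getElem?_map]

theorem storageOf_wf {S : Sig} {cs : List Create} (h : ∀ c ∈ cs, SlotWf S c.ty) {x σ}
    (hx : storageOf cs x = some σ) : SlotWf S σ := by
  rw [storageOf, lookup_map_eq, Option.map_eq_some_iff] at hx
  obtain ⟨c, hc, rfl⟩ := hx
  exact h c (List.mem_of_getElem? hc)

/-- In a well-formed state, an instance of a contract that a smaller well-typed signature declares
is typed by that signature. -/
theorem WellTyped.hasSlotTy_addressOf {d : Addr} {S₁ : Sig} (hS : WellTyped d S₁) :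
    ∀ {S : Sig}, S₁.Sub S → ∀ {s : State}, StateWf S s → ∀ {ℓ o}, s ℓ = some o →
      (S₁.storage o.type).isSome → HasSlotTy S₁ s (.base (.addr ℓ)) (.addressOf o.type) := by
  induction hS with
  | @intro S₁ T U dom cnstrSub cnstrWt cnstrTy transSub transWt transTy ih _ =>
    intro S hsub s hs ℓ o ho hA
    obtain ⟨C, c, h⟩ := hs ℓ o ho
    have hA' := dom _ hA
    obtain ⟨c₁, hc₁⟩ := Option.isSome_iff_exists.1 hA'
    cases h.cnstr.symm.trans (hsub.2.1 _ _ hc₁)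
    obtain ⟨C₁, hC₁, hty⟩ := cnstrTy _ _ hc₁
    cases h.storage.symm.trans (hsub.1 _ _ hC₁)
    obtain ⟨k, hk⟩ := List.exists_mem_of_ne_nil _ h.cases
    obtain ⟨hwf, rfl, -, -⟩ := hty.creates k hk
    refine .addrIsContract ho hC₁ rfl h.dom fun x σ v hσ hv => ?_
    have hd := (storageOf_wf hwf hσ).declared
    refine HasSlotTy.mono_sig (cnstrSub _ hA').1 ?_
    cases h.vals x σ v hσ hv with
    | map h => exact .map h
    | addressOf ho' =>
      cases hd with
      | addressOf hd => exact ih _ hA' ((cnstrSub _ hA').1.trans hsub) hs ho' hd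
    | contract ho' =>
      cases hd with
      | contract hd => exact .contract (ih _ hA' ((cnstrSub _ hA').1.trans hsub) hs ho' hd)

theorem WellTyped.hasSlotTy {d : Addr} {S₁ S : Sig} (hS : WellTyped d S₁) (hsub : S₁.Sub S)
    {s : State} (hs : StateWf S s) {v σ} (h : Shape s v σ) (hd : σ.Declared S₁) :
    HasSlotTy S₁ s v σ := by
  cases h with
  | map h => exact .map h
  | addressOf ho => cases hd with | addressOf hd => exact hS.hasSlotTy_addressOf hsub hs ho hd
  | contract ho =>
    cases hd with | contract hd => exact .contract (hS.hasSlotTy_addressOf hsub hs ho hd)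

/-! ## Type preservation for expressions that do not change the state -/

/-- Configurations that are well-typed for a part `S₁` of the signature `S`, with a well-formed
state. -/
structure ConfigWf (S S₁ : Sig) (I : Iface) (A? : Option Ident) (s : State) (ρ : Env) (ℓ : Addr) :
    Prop where
  sub : S₁.Sub S
  state : StateWf S s
  env : HasEnvTy S₁ s ρ I
  loc : HasLocTy S₁ s ℓ A?

theorem HasMapTy.base_inv {v β} (h : HasMapTy v (.base β)) : ∃ b, v = .base b ∧ HasBaseTy b β := by
  cases h with | base h => exact ⟨_, rfl, h⟩

theorem HasMapTy.int {n ι} (h : IntTy.Mem ι n) : HasMapTy (.base (.int n)) (.base (.int ι)) :=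
  .base (.int h)

theorem HasMapTy.bool {b} : HasMapTy (.base (.bool b)) (.base .bool) := .base .bool

theorem Entails.mem {S : Sig} {I : Iface} {Φ e : Exp} {A? : Option Ident} {ι : IntTy}
    (h : Entails S I Φ A? (.inrange ι e)) {s : State} {ρ : Env} {ℓ : Addr} (hρ : HasEnvTy S s ρ I)
    (hℓ : HasLocTy S s ℓ A?) (hΦ : EvalExp (.untimed s) ρ ℓ Φ vTrue) {v}
    (he : EvalExp (.untimed s) ρ ℓ e v) : HasMapTy v (.base (.int ι)) := by
  have h' := h s ρ ℓ hρ hℓ hΦ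
  generalize hv : vTrue = w at h'
  cases h' with
  | rangeTrue h₁ hn => cases he.det h₁; exact .int hn
  | rangeFalse => cases hv

mutual
theorem RefHasTy.sound {S S₁ : Sig} {I : Iface} {A? : Option Ident} {s : State} {ρ : Env}
    {ℓ : Addr} (c : ConfigWf S S₁ I A? s ρ ℓ) {k : RefTag} {t : Timing} {r : Ref} {σ : SlotTy} :
    RefHasTy S₁ I k A? t r σ → ∀ {v t'}, EvalRef (.untimed s) ρ ℓ r v t' → t = .untimed →
      Shape s v σ
  | .calldata h, v, t', he, ht => by
    cases he with
    | storage hx hρ =>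
      have := (c.env.dom _).2 (by rw [h]; rfl)
      simp [hρ] at this
    | calldata hb => exact (c.env.vars _ _ _ h hb).shape
  | .storage hC hx hI, v, t', he, ht => by
    cases he with
    | storage hv hρ =>
      cases HasSlotTy.shape c.loc with
      | contract ho => exact c.state.read ho (c.sub.1 _ _ hC) hx hv
    | calldata hb =>
      have := (c.env.dom _).1 (by rw [hb]; rfl)
      simp [hI] at this
  | .storagePre .., _, _, _, ht => nomatch ht
  | .storagePost .., _, _, _, ht => nomatch ht
  | .coerce h, v, t', he, ht => by
    cases he with
    | coerce he => cases h.sound c he ht with | addressOf ho => exact .contract ho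
  | .upcast h, v, t', he, ht => by
    cases h.sound c he ht with | addressOf ho => exact .map (.base .addr)
  | .field h hC hx, v, t', he, ht => by
    cases he with
    | field he hv =>
      cases h.sound c he ht with | contract ho => exact c.state.read ho (c.sub.1 _ _ hC) hx hv
  | .index hr hi, v, t', he, ht => by
    cases he with
    | index he₁ he₂ =>
      cases hr.sound c he₂ ht with
      | map hm =>
        cases hm with
        | mapping hm =>
          cases hi.sound c he₁ ht .bool with
          | base hb => exact .map (hm _ hb)
  | .environment h, v, t', he, ht => by
    cases he with
    | environment he =>
      cases h with
      | caller =>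
        cases he with
        | caller he =>
          obtain ⟨b, hb, hty⟩ := c.env.caller
          cases hb.symm.trans he
          exact .map (.base hty)
      | origin =>
        cases he with
        | origin he =>
          obtain ⟨b, hb, hty⟩ := c.env.origin
          cases hb.symm.trans he
          exact .map (.base hty)
      | callvalue =>
        cases he with
        | callvalue he =>
          obtain ⟨b, hb, hty⟩ := c.env.callvalue
          cases hb.symm.trans he
          exact .map (.base hty)
      | this =>
        cases he with
        | this => cases HasSlotTy.shape c.loc with | contract ho => exact .addressOf ho
theorem ExpHasTy.sound {S S₁ : Sig} {I : Iface} {A? : Option Ident} {s : State} {ρ : Env}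
    {ℓ : Addr} (c : ConfigWf S S₁ I A? s ρ ℓ) {Φ : Exp} {t : Timing} {e : Exp} {β : BaseTy} :
    ExpHasTy S₁ I Φ A? t e β → ∀ {v}, EvalExp (.untimed s) ρ ℓ e v → t = .untimed →
      EvalExp (.untimed s) ρ ℓ Φ vTrue → HasMapTy v (.base β)
  | .int h, _, he, _, _ => by cases he; exact .int h
  | .bool, _, he, _, _ => by cases he; exact .bool
  | .ref h, _, he, ht, _ => by
    cases he with
    | ref he =>
      have := h.sound c he ht
      cases this with | map h => exact h
  | .addr h, _, he, ht, _ => by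
    cases he with
    | addr he => cases h.sound c he rfl with | contract => exact .base .addr
  | .range h, _, he, ht, hΦ => by cases he <;> exact .bool
  | .bopI h₁ h₂ ht' hr, _, he, ht, hΦ => (hr ht).mem c.env c.loc hΦ he
  | .numConv (ι₂ := ι₂) h hr, _, he, ht, hΦ => by
    by_cases hι : ι₂ = .unbounded
    · subst hι
      obtain ⟨b, rfl, hb⟩ := (h.sound c he ht hΦ).base_inv
      cases hb
      exact .int trivial
    · exact (hr hι).mem c.env c.loc hΦ he
  | .bopB .., _, he, _, _ => by cases he; exact .bool
  | .neg .., _, he, _, _ => by cases he; exact .bool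
  | .cmp .., _, he, _, _ => by cases he; exact .bool
  | .ite h₁ h₂ h₃, _, he, ht, hΦ => by
    cases he with
    | iteTrue _ he => exact h₂.sound c he ht hΦ
    | iteFalse _ he => exact h₃.sound c he ht hΦ
  | .eq .., _, he, _, _ => by cases he <;> exact .bool
end

theorem MapTy.default_hasMapTy : ∀ μ : MapTy, HasMapTy μ.default μ
  | .base (.int ι) => .int (by
      cases ι with
      | uint k => exact ⟨le_rfl, by
          have : (1 : ℤ) ≤ 2 ^ (8 * (k.val + 1)) := one_le_pow₀ (by norm_num)
          omega⟩
      | sint k =>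
          have : (1 : ℤ) ≤ 2 ^ (8 * (k.val + 1) - 1) := one_le_pow₀ (by norm_num)
          exact ⟨by omega, by omega⟩
      | unbounded => trivial)
  | .base .bool => .bool
  | .base .address => .base .addr
  | .mapping _ μ => .mapping fun _ _ => μ.default_hasMapTy

theorem hasMapTy_overrideFn {X : Kind} {n : ℕ} {k : Fin n → X.Carrier} {u : Fin n → Value}
    {g : X.Carrier → Value} {μ : MapTy} {a : X.Carrier} (hu : ∀ i, HasMapTy (u i) μ)
    (hg : HasMapTy (g a) μ) : HasMapTy (overrideFn k u g a) μ := by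
  unfold overrideFn
  cases h : (List.ofFn fun i => (k i, u i)).lookup a with
  | none => exact hg
  | some w =>
    have : List.ofFn (fun i => (k i, u i)) = (List.finRange n).map fun i => (k i, u i) :=
      List.ofFn_eq_map
    rw [this, lookup_map_eq, Option.map_eq_some_iff] at h
    obtain ⟨i, -, rfl⟩ := h
    exact hu i

theorem MapHasTy.sound {S S₁ : Sig} {I : Iface} {A? : Option Ident} {s : State} {ρ : Env}
    {ℓ : Addr} (c : ConfigWf S S₁ I A? s ρ ℓ) {Φ : Exp} (hΦ : EvalExp (.untimed s) ρ ℓ Φ vTrue)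
    {m : MapExp} {μ : MapTy} (h : MapHasTy S₁ I Φ A? m μ) {v} (he : EvalMap s ρ ℓ m v) :
    HasMapTy v μ := by
  induction h generalizing v with
  | exp h => cases he with | exp he => exact h.sound c he rfl hΦ
  | lit hk hv ih =>
    cases he with
    | lit hk' hu =>
      exact .mapping fun a _ => hasMapTy_overrideFn (fun i => ih i (hu i))
        (MapTy.default_hasMapTy _)
  | upd hr hk hv ih =>
    cases he with
    | upd hr' hk' hu =>
      have hf := hr.sound c hr' rfl
      refine .mapping fun a ha => hasMapTy_overrideFn (fun i => ih i (hu i)) ?_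
      cases hf with
      | map hf =>
        generalize hw : MapTy.mapping _ _ = w at hf
        generalize hx : Value.fn _ _ = x at hf
        cases hf with
        | base => cases hx
        | mapping hf =>
          cases hw
          cases hx
          exact hf a ha

/-! ## Slot expressions, creates and constructors -/

theorem IsFresh.eq_none {s : State} {ℓ : Addr} (h : IsFresh s ℓ) : s ℓ = none := by
  obtain ⟨m, hm, rfl⟩ := h
  by_contra hne
  exact absurd (hm.1 (show m + 1 ∈ s.dom from Option.isSome_iff_ne_none.2 hne)) (Nat.not_succ_le_self m)

theorem IsFresh.ext {s : State} {ℓ : Addr} (h : IsFresh s ℓ) (o : Obj) :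
    s.Ext (Function.update s ℓ (some o)) := by
  intro ℓ' o' ho'
  rw [Function.update_of_ne, ho']
  rintro rfl
  simp [h.eq_none] at ho'

theorem State.Ext.chain {n : ℕ} {st : Fin (n + 1) → State}
    (h : ∀ i : Fin n, (st i.castSucc).Ext (st i.succ)) (i : Fin (n + 1)) :
    (st i).Ext (st (Fin.last n)) := by
  induction i using Fin.reverseInduction with
  | last => exact .refl _
  | cast i ih => exact (h i).trans ih

mutual
theorem EvalSlot.ext {S : Sig} {d : Addr} {s : State} {ρ : Env} {ℓ : Addr} {se : SlotExp}
    {v : Value} {s₂ : State} : EvalSlot S d s ρ ℓ se v s₂ → s.Ext s₂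
  | .map _ => .refl _
  | .ref _ => .refl _
  | .addr h => h.ext
  | @EvalSlot.new _ _ _ _ _ _ _ _ _ _ _ st _ _ _ _ hargs _ hcases =>
    (State.Ext.chain (fun i => (hargs i).ext) 0).trans hcases.ext
  | @EvalSlot.newPayable _ _ _ _ _ _ _ _ _ _ _ _ _ _ st _ _ _ _ hargs hvalue _ hcases =>
    (State.Ext.chain (fun i => (hargs i).ext) 0).trans (hvalue.ext.trans hcases.ext)
theorem EvalCreates.ext {S : Sig} {d : Addr} {s : State} {ρ : Env} {cs : List Create} {A : Ident}
    {ℓ : Addr} {s₂ : State} : EvalCreates S d s ρ cs A ℓ s₂ → s.Ext s₂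
  | @EvalCreates.intro _ _ _ _ _ _ st v hse hℓ =>
    (State.Ext.chain (fun i => (hse i).ext) 0).trans (hℓ.ext _)
theorem EvalCtorCases.ext {S : Sig} {d : Addr} {s : State} {ρ : Env} {cases : List CtorCase}
    {A : Ident} {ℓ : Addr} {s₂ : State} : EvalCtorCases S d s ρ cases A ℓ s₂ → s.Ext s₂
  | .intro _ _ _ hc => hc.ext
end

mutual
theorem EvalSlot.mono_sig {S₁ S : Sig} (hS : S₁.Sub S) {d : Addr} {s : State} {ρ : Env} {ℓ : Addr}
    {se : SlotExp} {v : Value} {s₂ : State} :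
    EvalSlot S₁ d s ρ ℓ se v s₂ → EvalSlot S d s ρ ℓ se v s₂
  | .map h => .map h
  | .ref h => .ref h
  | .addr h => .addr (h.mono_sig hS)
  | @EvalSlot.new _ _ _ _ _ _ _ _ _ _ _ st _ hctor hpay hlen hargs ho hcases =>
    .new (hS.2.1 _ _ hctor) hpay hlen (fun i => (hargs i).mono_sig hS) ho (hcases.mono_sig hS)
  | @EvalSlot.newPayable _ _ _ _ _ _ _ _ _ _ _ _ _ _ st _ hctor hpay hlen hargs hvalue ho hcases =>
    .newPayable (hS.2.1 _ _ hctor) hpay hlen (fun i => (hargs i).mono_sig hS)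
      (hvalue.mono_sig hS) ho (hcases.mono_sig hS)
theorem EvalCreates.mono_sig {S₁ S : Sig} (hS : S₁.Sub S) {d : Addr} {s : State} {ρ : Env}
    {cs : List Create} {A : Ident} {ℓ : Addr} {s₂ : State} :
    EvalCreates S₁ d s ρ cs A ℓ s₂ → EvalCreates S d s ρ cs A ℓ s₂
  | @EvalCreates.intro _ _ _ _ _ _ st v hse hℓ => .intro (fun i => (hse i).mono_sig hS) hℓ
theorem EvalCtorCases.mono_sig {S₁ S : Sig} (hS : S₁.Sub S) {d : Addr} {s : State} {ρ : Env}
    {cases : List CtorCase} {A : Ident} {ℓ : Addr} {s₂ : State} :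
    EvalCtorCases S₁ d s ρ cases A ℓ s₂ → EvalCtorCases S d s ρ cases A ℓ s₂
  | .intro j hj hi hc => .intro j hj hi (hc.mono_sig hS)
end

theorem ConfigWf.ext {S S₁ : Sig} {I : Iface} {A? : Option Ident} {s s' : State} {ρ : Env}
    {ℓ : Addr} (c : ConfigWf S S₁ I A? s ρ ℓ) (hs : s.Ext s') (hs' : StateWf S s') :
    ConfigWf S S₁ I A? s' ρ ℓ where
  sub := c.sub
  state := hs'
  env := { c.env with vars := fun x α b hx hb => (c.env.vars x α b hx hb).mono_state hs }
  loc := by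
    cases A? with
    | none => trivial
    | some A => exact HasSlotTy.mono_state hs c.loc

theorem EvalExp.ext {s s' : State} (hs : s.Ext s') {ρ : Env} {ℓ : Addr} {e : Exp} {v : Value}
    (h : EvalExp (.untimed s) ρ ℓ e v) : EvalExp (.untimed s') ρ ℓ e v :=
  h.mono (.untimed hs) (.refl ρ)

/-- Preservation along a sequence of evaluations that thread the state. -/
theorem ConfigWf.chain {S S₁ : Sig} {I : Iface} {A? : Option Ident} {ρ : Env} {ℓ : Addr} {n : ℕ}
    {st : Fin (n + 1) → State} (c : ConfigWf S S₁ I A? (st 0) ρ ℓ) {Φ : Exp}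
    (hΦ : EvalExp (.untimed (st 0)) ρ ℓ Φ vTrue)
    (hext : ∀ i : Fin n, (st i.castSucc).Ext (st i.succ)) {v : Fin n → Value} {σ : Fin n → SlotTy}
    {P : Fin n → Prop}
    (step : ∀ i : Fin n, ConfigWf S S₁ I A? (st i.castSucc) ρ ℓ →
      EvalExp (.untimed (st i.castSucc)) ρ ℓ Φ vTrue →
      StateWf S (st i.succ) ∧ Shape (st i.succ) (v i) (σ i) ∧ P i) :
    ConfigWf S S₁ I A? (st (Fin.last n)) ρ ℓ ∧
      EvalExp (.untimed (st (Fin.last n))) ρ ℓ Φ vTrue ∧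
      ∀ i, Shape (st (Fin.last n)) (v i) (σ i) ∧ P i := by
  have h : ∀ i, ConfigWf S S₁ I A? (st i) ρ ℓ ∧ EvalExp (.untimed (st i)) ρ ℓ Φ vTrue := by
    intro i
    induction i using Fin.induction with
    | zero => exact ⟨c, hΦ⟩
    | succ i ih => exact ⟨ih.1.ext (hext i) (step i ih.1 ih.2).1, ih.2.ext (hext i)⟩
  refine ⟨(h _).1, (h _).2, fun i => ?_⟩
  obtain ⟨-, h₂, h₃⟩ := step i (h _).1 (h _).2
  exact ⟨h₂.mono (State.Ext.chain hext i.succ).tyLe, h₃⟩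

theorem WellTyped.ctor {d : Addr} {S : Sig} (hS : WellTyped d S) {A : Ident} {c : Ctor}
    (hc : S.cnstr A = some c) :
    ∃ T C, T.Sub S ∧ WellTyped d T ∧ S.storage A = some C ∧ CtorHasTy T d A c C := by
  cases hS with
  | intro T U dom cnstrSub cnstrWt cnstrTy transSub transWt transTy =>
    obtain ⟨C, hC, h⟩ := cnstrTy A c hc
    have hA : (S.cnstr A).isSome := by rw [hc]; rfl
    exact ⟨T A, C, (cnstrSub A hA).1, cnstrWt A hA, hC, h⟩

theorem Iface.ty_eq (I : Iface) (x : Ident) : I.ty x = (I[I.names.idxOf x]?).map Prod.snd := by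
  have := lookup_map_eq I Prod.fst Prod.snd x
  simpa [Iface.ty, Iface.names] using this

theorem HasEnvTy.callEnv {S S₁ : Sig} {d : Addr} (hS : WellTyped d S₁) (hsub : S₁.Sub S)
    {s : State} (hs : StateWf S s) {I : Iface} (hI : IfaceWf S₁ I) {n : ℕ} (hn : I.length = n)
    {b : Fin n → BaseValue}
    (hb : ∀ i : Fin n, Shape s (.base (b i)) (I.get (i.cast hn.symm)).2.toSlot)
    {c o w : BaseValue} (hc : HasBaseTy c .address) (ho : HasBaseTy o .address)
    (hw : HasBaseTy w BaseTy.uint256) :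
    HasEnvTy S₁ s (callEnv I.names (List.ofFn b) c o w) I := by
  subst hn
  have hvar : ∀ x, Act.callEnv I.names (List.ofFn b) c o w (.var x) =
      (List.ofFn b)[I.names.idxOf x]? :=
    fun x => lookup_zip_eq (by simp [Iface.names]) x
  refine ⟨fun x => ?_, fun x α bv hα hbv => ?_, ⟨c, rfl, hc⟩, ⟨o, rfl, ho⟩, ⟨w, rfl, hw⟩⟩
  · rw [hvar, I.ty_eq]
    simp
  · rw [hvar, List.getElem?_ofFn] at hbv
    rw [I.ty_eq] at hα
    split at hbv
    · rename_i hlt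
      cases hbv
      rw [List.getElem?_eq_getElem hlt] at hα
      cases hα
      exact hS.hasSlotTy hsub hs (hb ⟨_, hlt⟩) (hI _ (List.getElem_mem hlt)).declared
    · cases hbv

theorem bindArgs_envExt (xs : List Ident) (bs : List BaseValue) (c o w : BaseValue) :
    EnvExt (bindArgs xs bs) (callEnv xs bs c o w) := by
  refine ⟨fun _ => rfl, fun k b h => ?_⟩
  cases k <;> first | exact h | cases h

theorem evalExp_bigAnd {ts : TState} {ρ : Env} {ℓ : Addr} {es : List Exp}
    (h : ∀ e ∈ es, EvalExp ts ρ ℓ e vTrue) : EvalExp ts ρ ℓ (bigAnd es) vTrue := by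
  induction es with
  | nil => exact .bool
  | cons e es ih =>
    exact .bopB (h e List.mem_cons_self) (ih fun e' he' => h e' (List.mem_cons_of_mem _ he'))

theorem zero_uint256 : HasBaseTy (.int 0) BaseTy.uint256 := .int ⟨le_rfl, by norm_num⟩

/-- The state after the creation of a conforming object is well-formed. -/
theorem StateWf.create {S : Sig} {s : State} (hs : StateWf S s) {ℓ : Addr} (hℓ : IsFresh s ℓ)
    {A : Ident} {c : Ctor} {cs : List Create} (hC : S.storage A = some (storageOf cs))
    (hc : S.cnstr A = some c) (hne : c.cases ≠ []) {v : Fin cs.length → Value}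
    (hv : ∀ i : Fin cs.length, Shape s (v i) (cs.get i).ty) :
    StateWf S (Function.update s ℓ
      (some ⟨A, fun x => ((cs.map Create.name).zip (List.ofFn v)).lookup x⟩)) := by
  have hext := (hℓ.ext ⟨A, fun x => ((cs.map Create.name).zip (List.ofFn v)).lookup x⟩).tyLe
  intro ℓ' o' ho'
  by_cases h : ℓ' = ℓ
  · subst h
    rw [Function.update_self] at ho'
    cases ho'
    refine ⟨storageOf cs, c, hC, hc, hne, fun x => ?_, fun x σ w hσ hw => ?_⟩
    · simp only [lookup_zip_eq (show (cs.map Create.name).length = (List.ofFn v).length by simp),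
        storageOf, lookup_map_eq, ← Option.isSome_iff_exists]
      simp
    · simp only [lookup_zip_eq (show (cs.map Create.name).length = (List.ofFn v).length by simp),
        List.getElem?_ofFn] at hw
      rw [storageOf, lookup_map_eq] at hσ
      split at hw
      · rename_i hlt
        cases hw
        rw [List.getElem?_eq_getElem hlt] at hσ
        cases hσ
        exact (hv ⟨_, hlt⟩).mono hext
      · cases hw
  · rw [Function.update_of_ne h] at ho'
    obtain ⟨C, c, hw⟩ := hs ℓ' o' ho'
    exact ⟨C, c, hw.mono hext⟩

mutual
theorem EvalSlot.sound {S : Sig} {d : Addr} {s : State} {ρ : Env} {ℓ : Addr} {se : SlotExp}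
    {v : Value} {s₂ : State} : EvalSlot S d s ρ ℓ se v s₂ →
    ∀ {S₁ I Φ A? σ}, WellTyped d S₁ → ConfigWf S S₁ I A? s ρ ℓ →
      EvalExp (.untimed s) ρ ℓ Φ vTrue → SlotHasTy S₁ d I Φ A? se σ →
      StateWf S s₂ ∧ Shape s₂ v σ ∧ EvalSlot S₁ d s ρ ℓ se v s₂
  | .map h, _, _, _, _, _, hS, c, hΦ, .map hm => ⟨c.state, .map (hm.sound c hΦ h), .map h⟩
  | .ref h, _, _, _, _, _, hS, c, hΦ, .ref hr => ⟨c.state, hr.sound c h rfl, .ref h⟩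
  | .addr h, _, _, _, _, _, hS, c, hΦ, .addr hse => by
    obtain ⟨h₁, h₂, h₃⟩ := h.sound hS c hΦ hse
    cases h₂ with
    | contract ho => exact ⟨h₁, .addressOf ho, .addr h₃⟩
  | @EvalSlot.new _ _ _ _ _ _ _ _ o _ _ st b hctor hpay hlen hargs ho hcases,
      S₁, _, _, _, _, hS, c, hΦ, hty => by
    have ih := fun i => @EvalSlot.sound _ _ _ _ _ _ _ _ (hargs i)
    have ihc := @EvalCtorCases.sound _ _ _ _ _ _ _ _ hcases
    cases hty with
    | new hctor₁ hpay₁ hargs₁ hiffs =>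
      cases hctor.symm.trans (c.sub.2.1 _ _ hctor₁)
      obtain ⟨hlast, -, hv⟩ := c.chain hΦ (fun i => (hargs i).ext)
        (fun i ci hi => ih i hS ci hi (hargs₁ i))
      obtain ⟨T, C, hTS, hT, hC, hct⟩ := hS.ctor hctor₁
      obtain ⟨ob, hob, hobty⟩ := c.env.origin
      cases ho.symm.trans hob
      have hTsub := hTS.trans c.sub
      obtain ⟨h₁, h₂, h₃⟩ := ihc hT hct (c.sub.1 _ _ hC) hctor rfl
        ⟨hTsub, hlast.state, .callEnv hT hTsub hlast.state hct.wf rfl (fun i => (hv i).1) .addr hobty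
          zero_uint256, trivial⟩
        (fun p hp => (hiffs st _ _ b c.env c.loc hΦ (fun i => (hv i).2) p hp).mono
          (.untimed (.refl _)) (bindArgs_envExt ..))
      exact ⟨h₁, h₂, .new hctor₁ hpay rfl (fun i => (hv i).2) ho (h₃.mono_sig hTS)⟩
  | @EvalSlot.newPayable _ _ _ _ _ _ _ _ _ o w s₁ _ _ st b hctor hpay hlen hargs hvalue ho hcases,
      S₁, _, _, _, _, hS, c, hΦ, hty => by
    have ih := fun i => @EvalSlot.sound _ _ _ _ _ _ _ _ (hargs i)
    have ihv := @EvalSlot.sound _ _ _ _ _ _ _ _ hvalue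
    have ihc := @EvalCtorCases.sound _ _ _ _ _ _ _ _ hcases
    cases hty with
    | newPayable hctor₁ hpay₁ hargs₁ hvalue₁ hiffs =>
      cases hctor.symm.trans (c.sub.2.1 _ _ hctor₁)
      obtain ⟨hlast, hΦ', hv⟩ := c.chain hΦ (fun i => (hargs i).ext)
        (fun i ci hi => ih i hS ci hi (hargs₁ i))
      obtain ⟨hs₁, hw, hev⟩ := ihv hS hlast hΦ' hvalue₁
      obtain ⟨T, C, hTS, hT, hC, hct⟩ := hS.ctor hctor₁
      obtain ⟨ob, hob, hobty⟩ := c.env.origin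
      cases ho.symm.trans hob
      have hTsub := hTS.trans c.sub
      have hwty : HasBaseTy w BaseTy.uint256 := by
        generalize hx : Value.base w = x at hw
        cases hw with
        | map hw =>
          subst hx
          cases hw with | base hw => exact hw
      obtain ⟨h₁, h₂, h₃⟩ := ihc hT hct (c.sub.1 _ _ hC) hctor rfl
        ⟨hTsub, hs₁, .callEnv hT hTsub hs₁ hct.wf rfl
          (fun i => (hv i).1.mono hvalue.ext.tyLe) .addr hobty hwty, trivial⟩
        (fun p hp => (hiffs st _ _ b c.env c.loc hΦ (fun i => (hv i).2) p hp).mono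
          (.untimed hvalue.ext) (bindArgs_envExt ..))
      exact ⟨h₁, h₂, .newPayable hctor₁ hpay rfl (fun i => (hv i).2) hev ho (h₃.mono_sig hTS)⟩
theorem EvalCreates.sound {S : Sig} {d : Addr} {s : State} {ρ : Env} {cs : List Create} {A : Ident}
    {ℓ : Addr} {s₂ : State} : EvalCreates S d s ρ cs A ℓ s₂ →
    ∀ {S₁ I Φ C c}, WellTyped d S₁ → ConfigWf S S₁ I none s ρ d →
      EvalExp (.untimed s) ρ d Φ vTrue → CreatesHasTy S₁ d I Φ cs C →
      S.storage A = some C → S.cnstr A = some c → c.cases ≠ [] →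
      StateWf S s₂ ∧ Shape s₂ (.base (.addr ℓ)) (.contract A) ∧ EvalCreates S₁ d s ρ cs A ℓ s₂
  | @EvalCreates.intro _ _ _ _ _ _ st v hse hℓ, S₁, I, Φ, C, ctor, hS, c, hΦ, hty, hC, hc, hne => by
    have ih := fun i => @EvalSlot.sound _ _ _ _ _ _ _ _ (hse i)
    obtain ⟨-, rfl, -, htys⟩ := hty
    obtain ⟨hlast, -, hv⟩ := c.chain hΦ (fun i => (hse i).ext)
      (fun i ci hi => ih i hS ci hi (htys _ (List.get_mem _ i)))
    exact ⟨hlast.state.create hℓ hC hc hne fun i => (hv i).1,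
      .contract (o := ⟨A, _⟩) (Function.update_self ..), .intro (fun i => (hv i).2) hℓ⟩
theorem EvalCtorCases.sound {S : Sig} {d : Addr} {s : State} {ρ : Env} {cases : List CtorCase}
    {A : Ident} {ℓ : Addr} {s₂ : State} : EvalCtorCases S d s ρ cases A ℓ s₂ →
    ∀ {T c C}, WellTyped d T → CtorHasTy T d A c C → S.storage A = some C →
      S.cnstr A = some c → cases = c.cases → ConfigWf S T c.iface none s ρ d →
      (∀ p ∈ c.iffs, EvalExp (.untimed s) ρ d p vTrue) →
      StateWf S s₂ ∧ Shape s₂ (.base (.addr ℓ)) (.contract A) ∧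
        EvalCtorCases T d s ρ cases A ℓ s₂
  | .intro j hj hi hcr, T, c, C, hT, hct, hC, hc, hcases, hconf, hiffs => by
    have hmem := List.get_mem cases j
    obtain ⟨h₁, h₂, h₃⟩ := hcr.sound hT hconf (.bopB hj (evalExp_bigAnd hiffs))
      (hct.creates _ (hcases ▸ hmem)) hC hc (hcases ▸ List.ne_nil_of_mem hmem)
    exact ⟨h₁, h₂, .intro j hj hi h₃⟩
end

/-! ## Updates, transitions and steps -/

theorem State.TyLe.write {s : State} {ℓ : Addr} {o : Obj} (ho : s ℓ = some o)
    (f : Ident → Option Value) :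
    s.TyLe (Function.update s ℓ (some { o with store := f })) := by
  intro ℓ' o' ho'
  by_cases h : ℓ' = ℓ
  · subst h
    cases ho.symm.trans ho'
    exact ⟨_, Function.update_self .., rfl⟩
  · exact ⟨o', by rw [Function.update_of_ne h, ho'], rfl⟩

theorem StateWf.write {S : Sig} {s : State} (hs : StateWf S s) {ℓ : Addr} {o : Obj}
    (ho : s ℓ = some o) {C : StorageTy} (hC : S.storage o.type = some C) {x : Ident} {σ : SlotTy}
    (hx : C x = some σ) {v : Value} (hv : Shape s v σ) :
    StateWf S (Function.update s ℓ
      (some { o with store := Function.update o.store x (some v) })) := by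
  have hle := State.TyLe.write ho (Function.update o.store x (some v))
  intro ℓ' o' ho'
  by_cases h : ℓ' = ℓ
  · subst h
    rw [Function.update_self] at ho'
    cases ho'
    obtain ⟨C', c, hw⟩ := hs _ o ho
    cases hC.symm.trans hw.storage
    refine ⟨C, c, hw.storage, hw.cnstr, hw.cases, fun y => ?_, fun y τ w hτ hw' => ?_⟩
    · by_cases hy : y = x
      · subst hy; simp [hx]
      · simp only [Function.update_of_ne hy, hw.dom]
    · by_cases hy : y = x
      · subst hy
        simp only [Function.update_self] at hw'
        cases hw'
        cases hx.symm.trans hτ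
        exact hv.mono hle
      · simp only [Function.update_of_ne hy] at hw'
        exact (hw.vals y τ w hτ hw').mono hle
  · rw [Function.update_of_ne h] at ho'
    obtain ⟨C, c, hw⟩ := hs ℓ' o' ho'
    exact ⟨C, c, hw.mono hle⟩

theorem Insert.sound {S S₁ : Sig} {I : Iface} {A? : Option Ident} {s s' : State} {ρ : Env}
    {ℓ : Addr} (c : ConfigWf S S₁ I A? s ρ ℓ) {r : Ref} {σ : SlotTy}
    (hr : RefHasTy S₁ I .storage A? .untimed r σ) {v : Value} (hv : Shape s v σ)
    (h : Insert ρ ℓ s r v s') : StateWf S s' ∧ s.TyLe s' := by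
  cases h with
  | storage ho hx =>
    refine ⟨?_, .write ho _⟩
    cases hr with
    | storage hC hσ hI =>
      cases HasSlotTy.shape c.loc with
      | contract ho' =>
        cases ho.symm.trans ho'
        exact c.state.write ho (c.sub.1 _ _ hC) hσ hv
  | field he ho hx =>
    refine ⟨?_, .write ho _⟩
    cases hr with
    | field hr hC hσ =>
      cases hr.sound c he rfl with
      | contract ho' =>
        cases ho.symm.trans ho'
        exact c.state.write ho (c.sub.1 _ _ hC) hσ hv

/-- Configurations stay well-typed when objects are modified but keep their contract names. -/
theorem ConfigWf.tyLe {S S₁ : Sig} {d : Addr} (hS : WellTyped d S₁) {I : Iface}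
    {A? : Option Ident} {s s' : State} {ρ : Env} {ℓ : Addr} (c : ConfigWf S S₁ I A? s ρ ℓ)
    (hs : s.TyLe s') (hs' : StateWf S s') : ConfigWf S S₁ I A? s' ρ ℓ where
  sub := c.sub
  state := hs'
  env :=
    { c.env with
      vars := fun x α b hx hb =>
        have h := c.env.vars x α b hx hb
        hS.hasSlotTy c.sub hs' (h.shape.mono hs) h.declared }
  loc := by
    cases A? with
    | none => trivial
    | some A =>
      have h : HasSlotTy S₁ s _ _ := c.loc
      exact hS.hasSlotTy c.sub hs' (h.shape.mono hs) h.declared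

theorem RefHasTy.storage_isSome {S : Sig} {I : Iface} {k : RefTag} {A? : Option Ident}
    {t : Timing} {r : Ref} {σ : SlotTy} :
    RefHasTy S I k A? t r σ → k = .storage → ∃ A, A? = some A ∧ (S.storage A).isSome
  | .storage hC _ _, _ => ⟨_, rfl, by rw [hC]; rfl⟩
  | .storagePre hC _ _, _ => ⟨_, rfl, by rw [hC]; rfl⟩
  | .storagePost hC _ _, _ => ⟨_, rfl, by rw [hC]; rfl⟩
  | .field h _ _, hk => h.storage_isSome hk

theorem EvalUpdates.sound {S S₁ : Sig} {d : Addr} (hS : WellTyped d S₁) {I : Iface} {A : Ident}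
    {s : State} {ρ : Env} {ℓ : Addr} (c : ConfigWf S S₁ I (some A) s ρ ℓ) {Φ : Exp}
    (hΦ : EvalExp (.untimed s) ρ ℓ Φ vTrue) {us : List Update} (hty : UpdatesWt S₁ d I Φ A us)
    {s₂ : State} (h : EvalUpdates S d s ρ ℓ us s₂) : StateWf S s₂ := by
  obtain ⟨st, wr, v, rfl, hst, hwr, hins, rfl⟩ := h
  obtain ⟨hlast, -, hv⟩ := c.chain hΦ (fun i => (hst i).ext)
    (fun i ci hi => (hst i).sound hS ci hi (hty.1 _ (List.get_mem us i)).2)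
  rw [← hwr] at hlast hv
  have key : ∀ i, ConfigWf S S₁ I (some A) (wr i) ρ ℓ ∧ (wr 0).TyLe (wr i) := by
    intro i
    induction i using Fin.induction with
    | zero => exact ⟨hlast, (State.Ext.refl _).tyLe⟩
    | succ i ih =>
      obtain ⟨hwf, hle⟩ := (hins i).sound ih.1 (hty.1 _ (List.get_mem us i)).1
        ((hv i).1.mono ih.2)
      exact ⟨ih.1.tyLe hS hle hwf, ih.2.trans hle⟩
  exact (key _).1.state

theorem HasEnvTy.restrict {S S₁ : Sig} {d : Addr} (hS : WellTyped d S₁) (hsub : S₁.Sub S)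
    {s : State} (hs : StateWf S s) {I : Iface} (hI : IfaceWf S₁ I) {ρ : Env}
    (h : HasEnvTy S s ρ I) : HasEnvTy S₁ s ρ I :=
  { h with
    vars := fun x α b hx hb => by
      refine hS.hasSlotTy hsub hs (h.vars x α b hx hb).shape ?_
      rw [I.ty_eq, Option.map_eq_some_iff] at hx
      obtain ⟨p, hp, rfl⟩ := hx
      exact (hI p (List.mem_of_getElem? hp)).declared }

theorem StepCnstr.stateWf {S : Sig} {d : Addr} (hS : WellTyped d S) {A : Ident} {ℓ : Addr}
    {s s₂ : State} (hs : StateWf S s) (h : StepCnstr S d A ℓ s s₂) : StateWf S s₂ := by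
  obtain ⟨ρ, c, hc, hρ, hiffs, hcases⟩ := h
  obtain ⟨T, C, hTS, hT, hC, hct⟩ := hS.ctor hc
  exact (hcases.sound hT hct hC hc rfl ⟨hTS, hs, hρ.restrict hT hTS hs hct.wf, trivial⟩ hiffs).1

theorem StepTrans.stateWf {S : Sig} {d : Addr} (hS : WellTyped d S) {A : Ident} {ℓ : Addr}
    {s s₂ : State} (hs : StateWf S s) (h : StepTrans S d A ℓ s s₂) : StateWf S s₂ := by
  obtain ⟨ρ, trs, tr, w, hℓ, htrs, htr, hρ, hiffs, j, hj, -, hup, -⟩ := h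
  cases hS with
  | intro T U dom cnstrSub cnstrWt cnstrTy transSub transWt transTy =>
    have hA : (S.trans A).isSome := by rw [htrs]; rfl
    have hU := transWt A hA
    have hUS := (transSub A hA).1
    have htw := transTy A trs htrs tr htr
    have hus := htw.updates _ (List.get_mem tr.cases j)
    by_cases hne : (tr.cases.get j).updates = []
    · obtain ⟨st, wr, v, rfl, -, hwr, -, rfl⟩ := hup
      generalize (tr.cases.get j).updates = us at hne st wr hwr hs
      subst hne
      exact hwr ▸ hs
    · obtain ⟨u, hu⟩ := List.exists_mem_of_ne_nil _ hne
      obtain ⟨A', e, hstor⟩ := (hus.1 u hu).1.storage_isSome rfl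
      cases e
      exact hup.sound hU ⟨hUS, hs, hρ.restrict hU hUS hs htw.wf,
        hU.hasSlotTy hUS hs hℓ.shape (.contract hstor)⟩ (.bopB hj (evalExp_bigAnd hiffs)) hus

theorem Possible.stateWf {S : Sig} {d : Addr} (hS : WellTyped d S) {s : State}
    (h : Possible S d s) : StateWf S s := by
  induction h with
  | refl => exact fun _ _ ho => nomatch ho
  | tail _ h ih =>
    rcases h with ⟨A, ℓ, h⟩ | ⟨A, ℓ, h⟩
    · exact h.stateWf hS ih
    · exact h.stateWf hS ih

end Act

theorem mainTheorem1 (d : Act.Addr) (S : Act.Sig) (hS : Act.WellTyped d S)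
    (s : Act.State) (hs : Act.Possible S d s) (ℓ : Act.Addr) (hℓ : ℓ ∈ s.dom) :
    ∃ A : Act.Ident, Act.HasSlotTy S s (.base (.addr ℓ)) (.contract A) := by
  have hwf := hs.stateWf hS
  obtain ⟨o, ho⟩ := Option.isSome_iff_exists.1 hℓ
  obtain ⟨C, c, h⟩ := hwf ℓ o ho
  exact ⟨o.type, hS.hasSlotTy (.refl S) hwf (.contract ho) (.contract (by rw [h.storage]; rfl))⟩
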